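/- Let $\square=(0,1)^2$ and let $G_0$ be a finite union of smooth planar domains whose closures are pairwise disjoint and contained in $\square$. Put $Y=\overline{\square}\setminus\overline{G_0}$, denote by $|Y|$ its area, let $\langle u\rangle_Y=\frac1{|Y|}\int_Y u\,d\xi$, and assume that $Y$ is symmetric with respect to the lines $\xi_1=\frac12$ and $\xi_2=\frac12$. Let $G=\bigcup_{k,n\in\mathbb Z}(G_0+(k,n))$, and let $\vec\nu=(\nu_1,\nu_2)$ on the boundaries of the holes be the unit normal directed into the holes. Let $N_1$ be a solution, $1$-periodic in $\xi_1$ and $\xi_2$ and smooth on $\mathbb R^2\setminus G$ (up to the boundaries of the holes), of the cell problem $$\Delta N_1=0\ \text{ in } Y,\qquad \nabla N_1\cdot\vec\nu=-\nu_1\ \text{ on }\partial G_0,\qquad \langle N_1\rangle_Y=0,$$ and put $h_{11}=\langle 1+\partial_{\xi_1}N_1\rangle_Y$. Let $\ell\in C^4(\mathbb R)$ be $1$-periodic, even and non-positive with $\ell(0)=0$, and assume that the curve $\xi_1=\ell(\xi_2)$, $\xi_2\in\mathbb R$, does not meet $\partial G$. Let $$\lambda=\{\xi:\ \xi_1=\ell(\xi_2),\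 0<\xi_2<1\},\qquad \vec\nu=(\nu_1,\nu_2)=\frac{(1,\,-\ell'(\xi_2))}{\sqrt{1+|\ell'(\xi_2)|^2}}\ \text{ on }\lambda .$$ Then $$\int_\lambda\nabla N_1\cdot\vec\nu\,dl=-1+|Y|\,h_{11}.$$ Moreover, this number is the constant $\tilde J_1$ of the inner-layer problem, in the following sense. Let $\Upsilon^-=\{\xi_1<\ell(\xi_2),\ 0<\xi_2<1\}$ and $\Upsilon^+=\{\xi_1>\ell(\xi_2),\ 0<\xi_2<1\}\setminus\overline G$, and let $\mathfrak S^+$ be the part of $\partial G$ in $\{\xi_1>\ell(\xi_2),\ 0<\xi_2<1\}$. If $D^->0$, $q_1,\tilde J_1\in\mathbb R$, and if functions $B^\pm$, which are $1$-periodic in $\xi_2$ and twice continuously differentiable up to the interface and up to the boundaries of the holes, satisfy $$\Delta B^\pm=0\ \text{ in }\Upsilon^\pm,\qquad \nabla B^+\cdot\vec\nu=0\ \text{ on }\mathfrak S^+,\qquad B^+-B^-=-N_1+q_1\ \text{ on }\lambda,$$ $$(\nabla B^+-D^-\nabla B^-)\cdot\vec\nu=-\nabla N_1\cdot\vec\nu+\tilde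 J_1\,\nu_1\ \text{ on }\lambda,\qquad B^\pm\to0\ \text{ as }\xi_1\to\pm\infty\ \text{ uniformly in }\xi_2,$$ then $$\tilde J_1=\int_\lambda\nabla N_1\cdot\vec\nu\,dl=-1+|Y|\,h_{11}.$$ -/

import Mathlib

open MeasureTheory Filter Topology Set
open scoped ContDiff

namespace PerforatedCell

noncomputable section

/-- The partial derivative in the first variable. -/
def d1 (u : ℝ × ℝ → ℝ) (x : ℝ × ℝ) : ℝ := fderiv ℝ u x (1, 0)

/-- The partial derivative in the second variable. -/
def d2 (u : ℝ × ℝ → ℝ) (x : ℝ × ℝ) : ℝ := fderiv ℝ u x (0, 1)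

/-- The Laplace operator. -/
def lap (u : ℝ × ℝ → ℝ) (x : ℝ × ℝ) : ℝ := d1 (d1 u) x + d2 (d2 u) x

/-- The derivative of `u` at `x` in the direction `n`, that is `∇u(x) · n`. -/
def normalDeriv (u : ℝ × ℝ → ℝ) (x n : ℝ × ℝ) : ℝ := d1 u x * n.1 + d2 u x * n.2

/-- `ψ` is a smooth defining function of the set `S` near `x`: its gradient does not vanish at `x`
and near `x` the set `S` is `{ψ < 0}`. -/
def IsDefiningFunction (S : Set (ℝ × ℝ)) (x : ℝ × ℝ) (ψ : ℝ × ℝ → ℝ) : Prop :=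
  ContDiff ℝ ∞ ψ ∧ fderiv ℝ ψ x ≠ 0 ∧ ∀ᶠ y in 𝓝 x, (y ∈ S ↔ ψ y < 0)

/-- A smooth domain: a nonempty connected open set with a smooth boundary, lying locally on one
side of it. -/
structure IsSmoothDomain (D : Set (ℝ × ℝ)) : Prop where
  isOpen : IsOpen D
  isConnected : IsConnected D
  smooth_boundary : ∀ x ∈ frontier D, ∃ ψ, IsDefiningFunction D x ψ

/-- `n` is the unit normal to the boundary of `S` at `x` that is directed into `S`, hence external
to the complement of `S`. -/
def IsUnitNormalInto (S : Set (ℝ × ℝ)) (x n : ℝ × ℝ) : Prop :=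
  n.1 ^ 2 + n.2 ^ 2 = 1 ∧
    ∃ ψ, IsDefiningFunction S x ψ ∧ ∃ t : ℝ, 0 < t ∧ d1 ψ x = -t * n.1 ∧ d2 ψ x = -t * n.2

/-- `G` is a finite union of smooth domains whose closures are pairwise disjoint and lie strictly
inside the unit square. -/
def IsHoleSystem (G : Set (ℝ × ℝ)) : Prop :=
  ∃ (m : ℕ) (D : Fin m → Set (ℝ × ℝ)),
    (∀ i, IsSmoothDomain (D i)) ∧
    (∀ i j, i ≠ j → Disjoint (closure (D i)) (closure (D j))) ∧
    (∀ i, closure (D i) ⊆ Ioo (0 : ℝ) 1 ×ˢ Ioo (0 : ℝ) 1) ∧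
    G = ⋃ i, D i

/-- The periodicity cell: the closed unit square without the closed holes. -/
def cell (G : Set (ℝ × ℝ)) : Set (ℝ × ℝ) :=
  (Icc (0 : ℝ) 1 ×ˢ Icc (0 : ℝ) 1) \ closure G

/-- The cell is symmetric with respect to the lines `ξ₁ = 1/2` and `ξ₂ = 1/2`. -/
def IsSymmetricCell (G : Set (ℝ × ℝ)) : Prop :=
  (∀ x, x ∈ cell G ↔ (1 - x.1, x.2) ∈ cell G) ∧ (∀ x, x ∈ cell G ↔ (x.1, 1 - x.2) ∈ cell G)

/-- All integer translates of the holes. -/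
def periodicHoles (G : Set (ℝ × ℝ)) : Set (ℝ × ℝ) :=
  {x | ∃ k n : ℤ, (x.1 - k, x.2 - n) ∈ G}

/-- The mean value over the cell. -/
def cellAverage (G : Set (ℝ × ℝ)) (u : ℝ × ℝ → ℝ) : ℝ :=
  (1 / volume.real (cell G)) * ∫ x in cell G, u x

/-- `N` is a smooth periodic solution of the first cell problem. Only its values on the closed
perforated plane `(periodicHoles G)ᶜ` matter; smoothness up to the boundary means that `N` is
smooth near every point of that closed set. -/
structure IsCellSolution (G : Set (ℝ × ℝ)) (N : ℝ × ℝ → ℝ) : Prop where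
  smooth : ∀ x, x ∉ periodicHoles G → ContDiffAt ℝ ∞ N x
  periodic_fst : ∀ x : ℝ × ℝ, N (x.1 + 1, x.2) = N x
  periodic_snd : ∀ x : ℝ × ℝ, N (x.1, x.2 + 1) = N x
  harmonic : ∀ x ∈ cell G, lap N x = 0
  neumann : ∀ x ∈ frontier G, ∀ n, IsUnitNormalInto G x n → normalDeriv N x n = -n.1
  mean_zero : cellAverage G N = 0

/-- The homogenized coefficient `h₁₁ = ⟨1 + ∂N₁/∂ξ₁⟩_Y`. -/
def h11 (G : Set (ℝ × ℝ)) (N : ℝ × ℝ → ℝ) : ℝ := cellAverage G fun x => 1 + d1 N x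

/-- The profile of the interface: the curve `ξ₁ = ell ξ₂` does not meet the boundary of any hole
of the perforated plane. -/
structure IsInterfaceProfile (G : Set (ℝ × ℝ)) (ell : ℝ → ℝ) : Prop where
  smooth : ContDiff ℝ 4 ell
  periodic : ∀ t, ell (t + 1) = ell t
  even : ∀ t, ell (-t) = ell t
  nonpos : ∀ t, ell t ≤ 0
  zero : ell 0 = 0
  avoids_holes : ∀ t, (ell t, t) ∉ frontier (periodicHoles G)

/-- The unit normal `(1, -ell') / √(1 + ell'²)` to the interface at the point `(ell t, t)`. -/
def interfaceNormal (ell : ℝ → ℝ) (t : ℝ) : ℝ × ℝ :=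
  (1 / √(1 + deriv ell t ^ 2), -deriv ell t / √(1 + deriv ell t ^ 2))

/-- The integral with respect to arc length over the curve `λ = {(ell t, t) : 0 < t < 1}` of a
function given in terms of the parameter `t`. -/
def lineIntegral (ell : ℝ → ℝ) (f : ℝ → ℝ) : ℝ :=
  ∫ t in (0 : ℝ)..1, f t * √(1 + deriv ell t ^ 2)

/-- The part of the band `0 < ξ₂ < 1` on the left of the interface. -/
def bandMinus (ell : ℝ → ℝ) : Set (ℝ × ℝ) :=
  {x | x.1 < ell x.2 ∧ 0 < x.2 ∧ x.2 < 1}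

/-- The perforated part of the band `0 < ξ₂ < 1` on the right of the interface. -/
def bandPlus (G : Set (ℝ × ℝ)) (ell : ℝ → ℝ) : Set (ℝ × ℝ) :=
  {x | ell x.2 < x.1 ∧ 0 < x.2 ∧ x.2 < 1 ∧ x ∉ closure (periodicHoles G)}

/-- The pair `Bp`, `Bm` solves the first inner-layer problem with the constants `q` and `J`; `Dm`
is the diffusion coefficient on the left of the interface. Each of the functions is `1`-periodic
in the second variable and twice continuously differentiable up to the interface and to the
boundaries of the holes, and tends to zero at infinity uniformly in the second variable. -/
structure IsInnerLayerSolution (G : Set (ℝ × ℝ)) (ell : ℝ → ℝ) (N : ℝ × ℝ → ℝ) (Dm q J : ℝ)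
    (Bp Bm : ℝ × ℝ → ℝ) : Prop where
  smooth_plus : ∀ x : ℝ × ℝ, ell x.2 ≤ x.1 → x ∉ periodicHoles G → ContDiffAt ℝ 2 Bp x
  smooth_minus : ∀ x : ℝ × ℝ, x.1 ≤ ell x.2 → ContDiffAt ℝ 2 Bm x
  periodic_plus : ∀ x : ℝ × ℝ, Bp (x.1, x.2 + 1) = Bp x
  periodic_minus : ∀ x : ℝ × ℝ, Bm (x.1, x.2 + 1) = Bm x
  harmonic_plus : ∀ x ∈ bandPlus G ell, lap Bp x = 0
  harmonic_minus : ∀ x ∈ bandMinus ell, lap Bm x = 0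
  neumann : ∀ x ∈ frontier (periodicHoles G), ell x.2 < x.1 → 0 < x.2 → x.2 < 1 →
    ∀ n, IsUnitNormalInto (periodicHoles G) x n → normalDeriv Bp x n = 0
  jump : ∀ t ∈ Ioo (0 : ℝ) 1, Bp (ell t, t) - Bm (ell t, t) = -N (ell t, t) + q
  flux_jump : ∀ t ∈ Ioo (0 : ℝ) 1,
    normalDeriv Bp (ell t, t) (interfaceNormal ell t)
        - Dm * normalDeriv Bm (ell t, t) (interfaceNormal ell t)
      = -normalDeriv N (ell t, t) (interfaceNormal ell t) + J * (interfaceNormal ell t).1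
  decay_plus : Tendsto Bp (comap Prod.fst atTop ⊓ 𝓟 (bandPlus G ell)) (𝓝 0)
  decay_minus : Tendsto Bm (comap Prod.fst atBot ⊓ 𝓟 (bandMinus ell)) (𝓝 0)

end

end PerforatedCell

/-! The field `e₁ + ∇N` is divergence free outside the holes and tangential to their boundaries.
Multiplied by `ξ₁` it stays tangential and its divergence is `1 + ∂₁N`. In the region between the
interface and its translate by `(1, 0)` the lateral contributions cancel by periodicity in `ξ₂`.
Since `ξ₁` differs by exactly one on corresponding points of the two curves, where `∇N` takes the
same values, the total flux is that of `e₁ + ∇N` through a single curve. By periodicity in `ξ₁` the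
integral of `1 + ∂₁N` over this curved cell equals the one over the square cell, namely `|Y| h₁₁`;
the flux of `e₁` is `1`. This is `IsCellSolution.flux_eq`.

For the inner layer, integrate the flux condition over the interface: `J` is the flux of `∇N` once
the fluxes of `∇B⁺` and `∇B⁻` vanish. Each of these is the same through every integer translate of
the interface on its side (`IsCellHarmonic.flux_succ`). Only `B` itself is known to decay, not its
gradient, so a Caccioppoli argument is used: `IsCellHarmonic.abs_flux_le` bounds the flux by a
constant times the supremum of `|B|` over one cell, which tends to zero.

Both halves rest on a divergence theorem in perforated cells, `IsTangential.setIntegral_dvg`. As all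
fields involved are tangential to the holes, no boundary integral over the holes is needed:
`integral_dvg_pos_set_eq_zero` replaces it by a cutoff argument near the boundary, globalized by a
partition of unity. A shear straightens the outer boundary of the cell. -/

namespace PerforatedCell

/-! ### Partial derivatives and the divergence -/

/-- The divergence of the planar vector field `(F₁, F₂)`. -/
noncomputable def dvg (F₁ F₂ : ℝ × ℝ → ℝ) (x : ℝ × ℝ) : ℝ := d1 F₁ x + d2 F₂ x

lemma fderiv_apply_eq (u : ℝ × ℝ → ℝ) (x v : ℝ × ℝ) :
    fderiv ℝ u x v = d1 u x * v.1 + d2 u x * v.2 := by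
  have h : v = v.1 • ((1 : ℝ), (0 : ℝ)) + v.2 • ((0 : ℝ), (1 : ℝ)) := by
    ext <;> simp
  conv_lhs => rw [h]
  rw [map_add, map_smul, map_smul]
  simp only [d1, d2, smul_eq_mul]
  ring

lemma contDiffAt_d1 {u : ℝ × ℝ → ℝ} {x : ℝ × ℝ} {m n : WithTop ℕ∞} (h : ContDiffAt ℝ n u x)
    (hmn : m + 1 ≤ n) : ContDiffAt ℝ m (d1 u) x :=
  (h.fderiv_right hmn).clm_apply contDiffAt_const

lemma contDiffAt_d2 {u : ℝ × ℝ → ℝ} {x : ℝ × ℝ} {m n : WithTop ℕ∞} (h : ContDiffAt ℝ n u x)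
    (hmn : m + 1 ≤ n) : ContDiffAt ℝ m (d2 u) x :=
  (h.fderiv_right hmn).clm_apply contDiffAt_const

lemma d1_mul {f g : ℝ × ℝ → ℝ} {x : ℝ × ℝ} (hf : DifferentiableAt ℝ f x)
    (hg : DifferentiableAt ℝ g x) :
    d1 (fun y => f y * g y) x = f x * d1 g x + d1 f x * g x := by
  simp only [d1]
  rw [fderiv_fun_mul hf hg]
  simp [mul_comm]

lemma d2_mul {f g : ℝ × ℝ → ℝ} {x : ℝ × ℝ} (hf : DifferentiableAt ℝ f x)
    (hg : DifferentiableAt ℝ g x) :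
    d2 (fun y => f y * g y) x = f x * d2 g x + d2 f x * g x := by
  simp only [d2]
  rw [fderiv_fun_mul hf hg]
  simp [mul_comm]

lemma dvg_smul {f F₁ F₂ : ℝ × ℝ → ℝ} {x : ℝ × ℝ} (hf : DifferentiableAt ℝ f x)
    (h₁ : DifferentiableAt ℝ F₁ x) (h₂ : DifferentiableAt ℝ F₂ x) :
    dvg (fun y => f y * F₁ y) (fun y => f y * F₂ y) x
      = f x * dvg F₁ F₂ x + (d1 f x * F₁ x + d2 f x * F₂ x) := by
  simp only [dvg]
  rw [d1_mul hf h₁, d2_mul hf h₂]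
  ring

lemma dvg_congr {F₁ F₂ F₁' F₂' : ℝ × ℝ → ℝ} {x : ℝ × ℝ} (h₁ : F₁ =ᶠ[𝓝 x] F₁')
    (h₂ : F₂ =ᶠ[𝓝 x] F₂') : dvg F₁ F₂ x = dvg F₁' F₂' x := by
  simp only [dvg, d1, d2, h₁.fderiv_eq, h₂.fderiv_eq]

lemma dvg_zero (x : ℝ × ℝ) : dvg (fun _ => 0) (fun _ => 0) x = 0 := by
  simp [dvg, d1, d2]

lemma continuousAt_dvg {F₁ F₂ : ℝ × ℝ → ℝ} {x : ℝ × ℝ} (h₁ : ContDiffAt ℝ 1 F₁ x)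
    (h₂ : ContDiffAt ℝ 1 F₂ x) : ContinuousAt (dvg F₁ F₂) x :=
  (contDiffAt_d1 (m := 0) h₁ (by simp)).continuousAt.add
    (contDiffAt_d2 (m := 0) h₂ (by simp)).continuousAt

lemma dvg_eq_zero_of_notMem_tsupport {F₁ F₂ : ℝ × ℝ → ℝ} {x : ℝ × ℝ} (h₁ : x ∉ tsupport F₁)
    (h₂ : x ∉ tsupport F₂) : dvg F₁ F₂ x = 0 := by
  rw [dvg_congr (notMem_tsupport_iff_eventuallyEq.1 h₁)
    (notMem_tsupport_iff_eventuallyEq.1 h₂)]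
  exact dvg_zero x

/-! ### The divergence theorem on one side of a smooth curve -/

/-- The divergence of a compactly supported field that is tangential, with a linear rate, to the
boundary of `{0 < ψ}` has zero integral over this set. -/
lemma integral_dvg_pos_set_eq_zero {V₁ V₂ ψ : ℝ × ℝ → ℝ} (h₁ : ContDiff ℝ 1 V₁)
    (h₂ : ContDiff ℝ 1 V₂) (c₁ : HasCompactSupport V₁) (c₂ : HasCompactSupport V₂)
    (hψ : ContDiff ℝ ∞ ψ) {C : ℝ}
    (hC : ∀ y, 0 < ψ y → |V₁ y * d1 ψ y + V₂ y * d2 ψ y| ≤ C * ψ y) :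
    ∫ y in {y | 0 < ψ y}, dvg V₁ V₂ y = 0 := by
  -- The cutoffs `η (n * ψ)` increase to the indicator of `{0 < ψ}`. Integration by parts leaves `n
  -- η'(nψ) V·∇ψ`, which lives where `0 < nψ ≤ 1`; there `|V·∇ψ| ≤ Cψ` compensates the factor `n`.
  -- So it is bounded uniformly in `n` and tends to zero pointwise.
  set η := Real.smoothTransition with hη
  have hηs : ContDiff ℝ 1 η := Real.smoothTransition.contDiff (n := 1)
  have hηc : Continuous (deriv η) := hηs.continuous_deriv le_rfl
  -- The endpoint `s = 0` follows from `s < 0` by continuity of `η'`.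
  have hη0 : ∀ s ≤ 0, deriv η s = 0 := by
    have h : ∀ s < 0, deriv η s = 0 := by
      intro s hs
      have : η =ᶠ[𝓝 s] fun _ => 0 := by
        filter_upwards [Iio_mem_nhds hs] with y hy
        exact Real.smoothTransition.zero_of_nonpos hy.le
      rw [this.deriv_eq]; simp
    intro s hs
    have : closure (Iio (0 : ℝ)) ⊆ {s | deriv η s = 0} :=
      closure_minimal (fun s hs => h s hs) (isClosed_eq hηc continuous_const)
    exact this (by rw [closure_Iio]; exact hs)
  have hη1 : ∀ s, 1 < s → deriv η s = 0 := by
    intro s hs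
    have : η =ᶠ[𝓝 s] fun _ => 1 := by
      filter_upwards [Ioi_mem_nhds hs] with y hy
      exact Real.smoothTransition.one_of_one_le (le_of_lt hy)
    rw [this.deriv_eq]; simp
  obtain ⟨M, hM⟩ : ∃ M, ∀ s, ‖deriv η s‖ ≤ M := by
    apply HasCompactSupport.exists_bound_of_continuous _ hηc
    apply HasCompactSupport.of_support_subset_isCompact (isCompact_Icc (a := (0 : ℝ)) (b := 1))
    intro s hs
    by_contra hcon
    rw [mem_Icc, not_and_or, not_le, not_le] at hcon
    rcases hcon with h | h
    · exact hs (hη0 s h.le)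
    · exact hs (hη1 s h)
  have hM0 : 0 ≤ M := (norm_nonneg _).trans (hM 0)
  have hdV : Continuous (dvg V₁ V₂) := continuous_iff_continuousAt.2 fun x =>
    continuousAt_dvg h₁.contDiffAt h₂.contDiffAt
  set K := tsupport V₁ ∪ tsupport V₂ with hK
  have hKc : IsCompact K := c₁.isCompact.union c₂.isCompact
  have hdVc : HasCompactSupport (dvg V₁ V₂) := by
    apply HasCompactSupport.of_support_subset_isCompact hKc
    intro x hx
    by_contra hcon
    simp only [hK, mem_union, not_or] at hcon
    exact hx (dvg_eq_zero_of_notMem_tsupport hcon.1 hcon.2)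
  have hψ1 : ∀ x, DifferentiableAt ℝ ψ x := fun x => hψ.differentiable (by simp) x
  have hη' : ∀ s, HasDerivAt η (deriv η s) s := fun s =>
    (hηs.differentiable (by simp) s).hasDerivAt
  have hcut : ∀ n : ℕ, ∀ x, HasFDerivAt (fun y => η (n * ψ y))
      (deriv η (n * ψ x) • ((n : ℝ) • fderiv ℝ ψ x)) x := fun n x =>
    (hη' _).comp_hasFDerivAt x ((hψ1 x).hasFDerivAt.const_mul (n : ℝ))
  have hcutc : ∀ n : ℕ, Continuous fun y => η (n * ψ y) := fun n =>
    hηs.continuous.comp (continuous_const.mul hψ.continuous)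
  have hcutd : ∀ (n : ℕ) (v : ℝ × ℝ), Continuous fun y => fderiv ℝ (fun y => η (n * ψ y)) y v := by
    intro n v
    have : ContDiff ℝ 1 fun y => η (n * ψ y) :=
      hηs.comp (contDiff_const.mul (hψ.of_le (by simp)))
    exact (this.continuous_fderiv (by simp)).clm_apply continuous_const
  have hparts : ∀ (n : ℕ) (V : ℝ × ℝ → ℝ) (v : ℝ × ℝ), ContDiff ℝ 1 V → HasCompactSupport V →
      Integrable (fun x => η (n * ψ x) * fderiv ℝ V x v) ∧
      Integrable (fun x => fderiv ℝ (fun y => η (n * ψ y)) x v * V x) ∧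
      ∫ x, η (n * ψ x) * fderiv ℝ V x v
        = -∫ x, fderiv ℝ (fun y => η (n * ψ y)) x v * V x := by
    intro n V v hV cV
    have i1 : Integrable (fun x => η (n * ψ x) * fderiv ℝ V x v) :=
      ((hcutc n).mul ((hV.continuous_fderiv (by simp)).clm_apply
        continuous_const)).integrable_of_hasCompactSupport
        ((HasCompactSupport.fderiv_apply (𝕜 := ℝ) cV v).mul_left)
    have i2 : Integrable (fun x => fderiv ℝ (fun y => η (n * ψ y)) x v * V x) :=
      ((hcutd n v).mul hV.continuous).integrable_of_hasCompactSupport cV.mul_left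
    refine ⟨i1, i2, integral_mul_fderiv_eq_neg_fderiv_mul_of_integrable i2 i1 ?_ ?_ ?_⟩
    · exact ((hcutc n).mul hV.continuous).integrable_of_hasCompactSupport cV.mul_left
    · exact fun x _ => (hcut n x).differentiableAt
    · exact fun x _ => hV.differentiable (by simp) x
  have hid : ∀ n : ℕ, ∫ x, η (n * ψ x) * dvg V₁ V₂ x
      = -∫ x, deriv η (n * ψ x) * n * (V₁ x * d1 ψ x + V₂ x * d2 ψ x) := by
    intro n
    obtain ⟨a1, a2, a3⟩ := hparts n V₁ (1, 0) h₁ c₁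
    obtain ⟨b1, b2, b3⟩ := hparts n V₂ (0, 1) h₂ c₂
    have e1 : ∀ x, η (n * ψ x) * dvg V₁ V₂ x
        = η (n * ψ x) * fderiv ℝ V₁ x (1, 0) + η (n * ψ x) * fderiv ℝ V₂ x (0, 1) := by
      intro x; simp only [dvg, d1, d2]; ring
    have e2 : ∀ x, deriv η (n * ψ x) * n * (V₁ x * d1 ψ x + V₂ x * d2 ψ x)
        = fderiv ℝ (fun y => η (n * ψ y)) x (1, 0) * V₁ x
          + fderiv ℝ (fun y => η (n * ψ y)) x (0, 1) * V₂ x := by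
      intro x
      rw [(hcut n x).fderiv]
      simp only [d1, d2, smul_apply, smul_eq_mul]; ring
    simp_rw [e1, e2]
    rw [integral_add a1 b1, integral_add a2 b2, a3, b3]
    ring
  have hlim1 : Tendsto (fun n : ℕ => ∫ x, η (n * ψ x) * dvg V₁ V₂ x) atTop
      (𝓝 (∫ x, indicator {y | 0 < ψ y} (dvg V₁ V₂) x)) := by
    apply tendsto_integral_of_dominated_convergence (fun x => ‖dvg V₁ V₂ x‖)
    · exact fun n => ((hcutc n).mul hdV).aestronglyMeasurable
    · exact (hdV.integrable_of_hasCompactSupport hdVc).norm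
    · intro n
      refine Eventually.of_forall fun x => ?_
      rw [norm_mul]
      refine mul_le_of_le_one_left (norm_nonneg _) ?_
      rw [Real.norm_eq_abs, abs_of_nonneg (Real.smoothTransition.nonneg _)]
      exact Real.smoothTransition.le_one _
    · refine Eventually.of_forall fun x => ?_
      by_cases hx : 0 < ψ x
      · rw [indicator_of_mem (by exact hx)]
        refine tendsto_const_nhds.congr' ?_
        obtain ⟨n₀, hn₀⟩ := exists_nat_gt (1 / ψ x)
        filter_upwards [eventually_ge_atTop n₀] with n hn
        have : 1 ≤ (n : ℝ) * ψ x := by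
          have : 1 / ψ x ≤ n := hn₀.le.trans (by exact_mod_cast hn)
          rwa [div_le_iff₀ hx] at this
        rw [hη, Real.smoothTransition.one_of_one_le this, one_mul]
      · rw [indicator_of_notMem (by exact hx)]
        refine tendsto_const_nhds.congr fun n => ?_
        rw [hη, Real.smoothTransition.zero_of_nonpos, zero_mul]
        exact mul_nonpos_of_nonneg_of_nonpos (by positivity) (not_lt.1 hx)
  have hC0 : ∀ n : ℕ, ∀ x, ‖deriv η (n * ψ x) * n * (V₁ x * d1 ψ x + V₂ x * d2 ψ x)‖
      ≤ M * |C| := by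
    intro n x
    by_cases hx : 0 < ψ x
    · by_cases hx1 : 1 < n * ψ x
      · rw [hη1 _ hx1]; simp; positivity
      · rw [norm_mul, norm_mul, Real.norm_eq_abs (V₁ x * d1 ψ x + V₂ x * d2 ψ x), mul_assoc]
        refine mul_le_mul (hM _) ?_ (by positivity) hM0
        rw [Real.norm_natCast]
        calc (n : ℝ) * |V₁ x * d1 ψ x + V₂ x * d2 ψ x| ≤ n * (C * ψ x) := by
              gcongr; exact hC x hx
          _ ≤ n * (|C| * ψ x) := by gcongr; exact le_abs_self C
          _ = |C| * (n * ψ x) := by ring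
          _ ≤ |C| := mul_le_of_le_one_right (abs_nonneg _) (not_lt.1 hx1)
    · rw [hη0 _ (mul_nonpos_of_nonneg_of_nonpos (by positivity) (not_lt.1 hx))]; simp; positivity
  have hlim2 : Tendsto (fun n : ℕ => ∫ x, deriv η (n * ψ x) * n
      * (V₁ x * d1 ψ x + V₂ x * d2 ψ x)) atTop (𝓝 (∫ _ : ℝ × ℝ, (0 : ℝ))) := by
    apply tendsto_integral_of_dominated_convergence (indicator K fun _ => M * |C|)
    · intro n
      have d1c : Continuous (d1 ψ) := continuous_iff_continuousAt.2 fun x =>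
        (contDiffAt_d1 (m := 0) (hψ.contDiffAt (x := x)) (by simp)).continuousAt
      have d2c : Continuous (d2 ψ) := continuous_iff_continuousAt.2 fun x =>
        (contDiffAt_d2 (m := 0) (hψ.contDiffAt (x := x)) (by simp)).continuousAt
      have e1 := h₁.continuous
      have e2 := h₂.continuous
      have e3 := hψ.continuous
      exact Continuous.aestronglyMeasurable (by fun_prop)
    · exact (integrable_indicator_iff hKc.isClosed.measurableSet).2
        (integrableOn_const hKc.measure_lt_top.ne)
    · intro n
      refine Eventually.of_forall fun x => ?_
      by_cases hx : x ∈ K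
      · rw [indicator_of_mem hx]; exact hC0 n x
      · rw [indicator_of_notMem hx]
        simp only [hK, mem_union, not_or] at hx
        rw [image_eq_zero_of_notMem_tsupport hx.1, image_eq_zero_of_notMem_tsupport hx.2]
        simp
    -- Once `nψ > 1` the term is zero, and where `ψ ≤ 0` it is zero for every `n`.
    · refine Eventually.of_forall fun x => ?_
      refine tendsto_const_nhds.congr' ?_
      by_cases hx : 0 < ψ x
      · obtain ⟨n₀, hn₀⟩ := exists_nat_gt (1 / ψ x)
        filter_upwards [eventually_ge_atTop n₀] with n hn
        have : 1 < (n : ℝ) * ψ x := by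
          have : 1 / ψ x < n := hn₀.trans_le (by exact_mod_cast hn)
          rwa [div_lt_iff₀ hx] at this
        rw [hη1 _ this]; simp
      · refine Eventually.of_forall fun n => ?_
        beta_reduce
        rw [hη0 _ (mul_nonpos_of_nonneg_of_nonpos (by positivity) (not_lt.1 hx))]; simp
  have hms : MeasurableSet {y | 0 < ψ y} :=
    (isOpen_lt continuous_const hψ.continuous).measurableSet
  rw [← integral_indicator hms]
  have := tendsto_nhds_unique hlim1 ((hlim2.neg).congr fun n => (hid n).symm)
  simpa using this

/-- The case `ψ = 1`, for which `{0 < ψ}` is the whole plane. -/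
lemma integral_dvg_eq_zero {V₁ V₂ : ℝ × ℝ → ℝ} (h₁ : ContDiff ℝ 1 V₁)
    (h₂ : ContDiff ℝ 1 V₂) (c₁ : HasCompactSupport V₁) (c₂ : HasCompactSupport V₂) :
    ∫ y, dvg V₁ V₂ y = 0 := by
  simpa [d1, d2] using integral_dvg_pos_set_eq_zero h₁ h₂ c₁ c₂
    (contDiff_const (c := (1 : ℝ))) (C := 0) (by simp [d1, d2])

/-! ### Geometry near a smooth boundary point -/

lemma IsDefiningFunction.eq_zero {H : Set (ℝ × ℝ)} {x : ℝ × ℝ} {ψ : ℝ × ℝ → ℝ}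
    (h : IsDefiningFunction H x ψ) (hx : x ∈ frontier H) : ψ x = 0 := by
  obtain ⟨hs, -, he⟩ := h
  rcases lt_trichotomy (ψ x) 0 with h0 | h0 | h0
  · exfalso
    refine hx.2 (mem_interior_iff_mem_nhds.2 ?_)
    filter_upwards [he, hs.continuous.continuousAt.eventually (gt_mem_nhds h0)] with y h1 h2
    exact h1.2 h2
  · exact h0
  · exfalso
    refine (mem_closure_iff_frequently.1 hx.1) ?_
    filter_upwards [he, hs.continuous.continuousAt.eventually (lt_mem_nhds h0)] with y h1 h2 h3
    exact lt_asymm (h1.1 h3) h2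

lemma IsDefiningFunction.eventually_isDefiningFunction {H : Set (ℝ × ℝ)} {x : ℝ × ℝ}
    {ψ : ℝ × ℝ → ℝ} (h : IsDefiningFunction H x ψ) : ∀ᶠ y in 𝓝 x, IsDefiningFunction H y ψ := by
  obtain ⟨hs, hd, he⟩ := h
  have hc : Continuous (fderiv ℝ ψ) := hs.continuous_fderiv (by simp)
  filter_upwards [he.eventually_nhds, hc.continuousAt.eventually_ne hd] with y h1 h2
  exact ⟨hs, h2, h1⟩

/-- Near a smooth boundary point the closure is `{ψ ≤ 0}`, and a function that vanishes on the
boundary is bounded by a multiple of `ψ` outside. -/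
lemma IsDefiningFunction.exists_bound {H : Set (ℝ × ℝ)} {x : ℝ × ℝ} {ψ g : ℝ × ℝ → ℝ}
    (h : IsDefiningFunction H x ψ) (hx : x ∈ frontier H) (hg : ContDiffAt ℝ 1 g x)
    (hg0 : ∀ᶠ y in 𝓝 x, y ∈ frontier H → g y = 0) :
    ∃ C, 0 ≤ C ∧ ∀ᶠ y in 𝓝 x, (y ∈ closure H ↔ ψ y ≤ 0) ∧ (0 < ψ y → |g y| ≤ C * ψ y) := by
  have hx0 := h.eq_zero hx
  obtain ⟨hs, hd, he⟩ := h
  -- The direction `v` is normalized by `dψ(x) v = 1`, so near `x` moving along `-v` decreases `ψ`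
  -- at rate at least `1/2`. A point with `ψ ≤ 0` is thus a limit of points of `H`.
  obtain ⟨w, hw⟩ : ∃ w, fderiv ℝ ψ x w ≠ 0 := by
    by_contra! hcon
    exact hd (ContinuousLinearMap.ext hcon)
  set v := (fderiv ℝ ψ x w)⁻¹ • w with hv
  have hv1 : fderiv ℝ ψ x v = 1 := by
    rw [hv, map_smul, smul_eq_mul, inv_mul_cancel₀ hw]
  have hc : Continuous fun y => fderiv ℝ ψ y v :=
    (hs.continuous_fderiv (by simp)).clm_apply continuous_const
  have hhalf : ∀ᶠ y in 𝓝 x, 1 / 2 < fderiv ℝ ψ y v :=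
    hc.continuousAt.eventually (lt_mem_nhds (by beta_reduce; rw [hv1]; norm_num))
  obtain ⟨K, t, ht, hL⟩ := hg.exists_lipschitzOnWith
  obtain ⟨r, hr, hball⟩ := Metric.eventually_nhds_iff_ball.1
    (hhalf.and (he.and (hg0.and (eventually_mem_nhds_iff.2 ht))))
  have hdes : ∀ z : ℝ × ℝ, ∀ T : ℝ, 0 ≤ T →
      (∀ τ ∈ Icc 0 T, z - τ • v ∈ Metric.ball x r) → ψ (z - T • v) ≤ ψ z - T / 2 := by
    intro z T hT hin
    have hder : ∀ τ, HasDerivAt (fun τ : ℝ => ψ (z - τ • v)) (fderiv ℝ ψ (z - τ • v) (-v)) τ := by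
      intro τ
      have h1 : HasDerivAt (fun τ : ℝ => z - τ • v) (-v) τ := by
        simpa using ((hasDerivAt_id τ).smul_const v).const_sub z
      exact ((hs.differentiable (by simp) _).hasFDerivAt).comp_hasDerivAt τ h1
    have := (convex_Icc (0 : ℝ) T).image_sub_le_mul_sub_of_deriv_le
      (f := fun τ : ℝ => ψ (z - τ • v)) (C := -(1 / 2))
      (fun τ _ => (hder τ).continuousAt.continuousWithinAt)
      (fun τ _ => (hder τ).differentiableAt.differentiableWithinAt)
      (fun τ hτ => by
        rw [(hder τ).deriv, map_neg]
        have := (hball _ (hin τ (interior_subset hτ))).1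
        linarith)
      0 (left_mem_Icc.2 hT) T (right_mem_Icc.2 hT) hT
    simp only [zero_smul, sub_zero] at this
    linarith
  have hcl : ∀ z ∈ Metric.ball x r, ψ z ≤ 0 → z ∈ closure H := by
    intro z hz hz0
    have htend : Tendsto (fun τ : ℝ => z - τ • v) (𝓝 0) (𝓝 z) := by
      have : Continuous fun τ : ℝ => z - τ • v := by fun_prop
      simpa using this.tendsto 0
    have hev : ∀ᶠ τ : ℝ in 𝓝 0, z - τ • v ∈ Metric.ball x r :=
      htend.eventually (Metric.isOpen_ball.mem_nhds hz)
    obtain ⟨ε, hε, hεb⟩ := Metric.eventually_nhds_iff_ball.1 hev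
    have hev2 : ∀ᶠ τ : ℝ in 𝓝[>] 0, z - τ • v ∈ H := by
      filter_upwards [Ioo_mem_nhdsGT hε] with τ hτ
      have hin : ∀ σ ∈ Icc 0 τ, z - σ • v ∈ Metric.ball x r := by
        intro σ hσ
        apply hεb
        rw [Metric.mem_ball, Real.dist_eq, sub_zero, abs_of_nonneg hσ.1]
        exact hσ.2.trans_lt hτ.2
      have h1 := hdes z τ hτ.1.le hin
      refine ((hball _ (hin τ ⟨hτ.1.le, le_rfl⟩)).2.1).2 ?_
      have := hτ.1
      linarith
    exact mem_closure_of_tendsto (htend.mono_left nhdsWithin_le_nhds) hev2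
  -- From `y` with `ψ y > 0`, the descent reaches the boundary within time `2 ψ y`, that is within
  -- distance `2 ψ y ‖v‖`; `g` vanishes there and is `K`-Lipschitz.
  refine ⟨K * (2 * ‖v‖), by positivity, ?_⟩
  have hsmall : ∀ᶠ y in 𝓝 x, 2 * |ψ y| * ‖v‖ < r / 2 := by
    have : Continuous fun y => 2 * |ψ y| * ‖v‖ := by
      have := hs.continuous
      fun_prop
    refine this.continuousAt.eventually (gt_mem_nhds ?_)
    beta_reduce
    rw [hx0]; simp; positivity
  filter_upwards [Metric.ball_mem_nhds x hr, Metric.ball_mem_nhds x (half_pos hr), hsmall]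
    with y hy hy2 hys
  refine ⟨⟨fun hyc => ?_, hcl y hy⟩, fun hpos => ?_⟩
  -- If `ψ y > 0`, a whole neighbourhood of `y` misses `H`.
  · by_contra! hcon
    refine (mem_closure_iff_frequently.1 hyc) ?_
    filter_upwards [Metric.isOpen_ball.mem_nhds hy,
      hs.continuous.continuousAt.eventually (lt_mem_nhds hcon)] with z h1 h2 h3
    exact lt_asymm ((hball z h1).2.1.1 h3) h2
  · rw [abs_of_pos hpos] at hys
    have hin : ∀ τ ∈ Icc 0 (2 * ψ y), y - τ • v ∈ Metric.ball x r := by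
      intro τ hτ
      rw [Metric.mem_ball, dist_eq_norm] at hy2 ⊢
      calc ‖y - τ • v - x‖ = ‖(y - x) - τ • v‖ := by congr 1; abel
        _ ≤ ‖y - x‖ + ‖τ • v‖ := norm_sub_le _ _
        _ < r / 2 + r / 2 := by
            refine add_lt_add_of_lt_of_le hy2 (le_of_lt (lt_of_le_of_lt ?_ hys))
            rw [norm_smul, Real.norm_eq_abs, abs_of_nonneg hτ.1]
            gcongr
            exact hτ.2
        _ = r := by ring
    have hend := hdes y (2 * ψ y) (by positivity) hin
    have hcont : Continuous fun τ : ℝ => ψ (y - τ • v) := hs.continuous.comp (by fun_prop)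
    obtain ⟨τ, hτ, hτ0⟩ : (0 : ℝ) ∈ (fun τ : ℝ => ψ (y - τ • v)) '' Icc 0 (2 * ψ y) := by
      apply intermediate_value_Icc' (by positivity) hcont.continuousOn
      simp only [mem_Icc, zero_smul, sub_zero]
      constructor <;> linarith
    set z := y - τ • v with hz
    have hzb := hin τ hτ
    have hzf : z ∈ frontier H := by
      refine ⟨hcl z hzb (le_of_eq hτ0), fun hzi => ?_⟩
      have := (hball z hzb).2.1.1 (interior_subset hzi)
      exact absurd hτ0 this.ne
    have hgz : g z = 0 := (hball z hzb).2.2.1 hzf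
    have := hL.dist_le_mul y (mem_of_mem_nhds (hball y hy).2.2.2) z
      (mem_of_mem_nhds (hball z hzb).2.2.2)
    rw [Real.dist_eq, hgz, sub_zero, dist_eq_norm] at this
    calc |g y| ≤ K * ‖y - z‖ := this
      _ = K * (τ * ‖v‖) := by
          rw [hz, sub_sub_cancel, norm_smul, Real.norm_eq_abs, abs_of_nonneg hτ.1]
      _ ≤ K * ((2 * ψ y) * ‖v‖) := by gcongr; exact hτ.2
      _ = K * (2 * ‖v‖) * ψ y := by ring

/-! ### Tangential fields: localization and a partition of unity -/

lemma contDiffAt_of_notMem_tsupport {f : ℝ × ℝ → ℝ} {x : ℝ × ℝ} {n : WithTop ℕ∞}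
    (h : x ∉ tsupport f) : ContDiffAt ℝ n f x :=
  contDiffAt_const.congr_of_eventuallyEq (notMem_tsupport_iff_eventuallyEq.1 h)

lemma contDiff_mul_of_tsupport_subset {U : Set (ℝ × ℝ)} {φ F : ℝ × ℝ → ℝ}
    (hφ : ContDiff ℝ ∞ φ) (hs : tsupport φ ⊆ U) (hF : ∀ y ∈ U, ContDiffAt ℝ 1 F y) :
    ContDiff ℝ 1 fun y => φ y * F y := by
  rw [contDiff_iff_contDiffAt]
  intro y
  by_cases hy : y ∈ U
  · exact (hφ.of_le (by simp)).contDiffAt.mul (hF y hy)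
  · exact contDiffAt_of_notMem_tsupport fun h => hy (hs (tsupport_mul_subset_left h))

lemma dvg_mul_eq_zero_of_notMem {φ F₁ F₂ : ℝ × ℝ → ℝ} {y : ℝ × ℝ} (hy : y ∉ tsupport φ) :
    dvg (fun y => φ y * F₁ y) (fun y => φ y * F₂ y) y = 0 :=
  dvg_eq_zero_of_notMem_tsupport (fun h => hy (tsupport_mul_subset_left h))
    (fun h => hy (tsupport_mul_subset_left h))

lemma integrable_dvg {V₁ V₂ : ℝ × ℝ → ℝ} (h₁ : ContDiff ℝ 1 V₁) (h₂ : ContDiff ℝ 1 V₂)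
    (c₁ : HasCompactSupport V₁) (c₂ : HasCompactSupport V₂) : Integrable (dvg V₁ V₂) := by
  have hdV : Continuous (dvg V₁ V₂) := continuous_iff_continuousAt.2 fun x =>
    continuousAt_dvg h₁.contDiffAt h₂.contDiffAt
  apply hdV.integrable_of_hasCompactSupport
  apply HasCompactSupport.of_support_subset_isCompact (c₁.isCompact.union c₂.isCompact)
  intro x hx
  by_contra hcon
  simp only [mem_union, not_or] at hcon
  exact hx (dvg_eq_zero_of_notMem_tsupport hcon.1 hcon.2)

/-- The field `(F₁, F₂)` is continuously differentiable on `O` up to the boundary of the holes `H`,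
which is smooth inside `O`, and is tangential to it. -/
structure IsTangential (H O : Set (ℝ × ℝ)) (F₁ F₂ : ℝ × ℝ → ℝ) : Prop where
  smooth : ∀ x ∈ O, x ∉ H → ContDiffAt ℝ 1 F₁ x ∧ ContDiffAt ℝ 1 F₂ x
  smooth_boundary : ∀ x ∈ frontier H, x ∈ O → ∃ ψ, IsDefiningFunction H x ψ
  tangential : ∀ x ∈ frontier H, x ∈ O → ∀ ψ, IsDefiningFunction H x ψ →
    F₁ x * d1 ψ x + F₂ x * d2 ψ x = 0

/-- Inside the holes there is nothing to integrate, away from them the field has compact support in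
a smooth region, and at a boundary point the half-plane-like case applies. The open set `U` depends
only on `x`, so that a partition of unity can be subordinated to these sets. -/
lemma IsTangential.exists_local {H O : Set (ℝ × ℝ)} {F₁ F₂ : ℝ × ℝ → ℝ}
    (hF : IsTangential H O F₁ F₂) (hO : IsOpen O) (c₁ : HasCompactSupport F₁)
    (c₂ : HasCompactSupport F₂) {x : ℝ × ℝ} (hx : x ∈ O) :
    ∃ U, IsOpen U ∧ x ∈ U ∧ ∀ φ : ℝ × ℝ → ℝ, ContDiff ℝ ∞ φ → (∀ y, |φ y| ≤ 1) →
      tsupport φ ⊆ U →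
      IntegrableOn (dvg (fun y => φ y * F₁ y) (fun y => φ y * F₂ y)) (closure H)ᶜ ∧
      ∫ y in (closure H)ᶜ, dvg (fun y => φ y * F₁ y) (fun y => φ y * F₂ y) y = 0 := by
  by_cases hxc : x ∈ closure H
  · by_cases hxi : x ∈ interior H
    · refine ⟨interior H, isOpen_interior, hxi, fun φ hφ _ hs => ?_⟩
      have hz : ∀ y ∈ (closure H)ᶜ, dvg (fun y => φ y * F₁ y) (fun y => φ y * F₂ y) y = 0 :=
        fun y hy => dvg_mul_eq_zero_of_notMem fun h =>
          hy (subset_closure (interior_subset (hs h)))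
      exact ⟨(integrableOn_zero).congr_fun (fun y hy => (hz y hy).symm)
        isClosed_closure.measurableSet.compl, setIntegral_eq_zero_of_forall_eq_zero hz⟩
    · have hxf : x ∈ frontier H := ⟨hxc, hxi⟩
      obtain ⟨ψ, hψ⟩ := hF.smooth_boundary x hxf hx
      have hxH : x ∉ H := fun h => by
        have := hψ.2.2.self_of_nhds.1 h
        exact this.ne (hψ.eq_zero hxf)
      obtain ⟨hF1, hF2⟩ := hF.smooth x hx hxH
      have hd1 : ContDiffAt ℝ 1 (d1 ψ) x := contDiffAt_d1 (n := ∞) hψ.1.contDiffAt (by decide)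
      have hd2 : ContDiffAt ℝ 1 (d2 ψ) x := contDiffAt_d2 (n := ∞) hψ.1.contDiffAt (by decide)
      -- The same `ψ` is a defining function at all nearby boundary points, so `F·∇ψ` vanishes on
      -- the boundary near `x` and is therefore `O(ψ)` outside.
      obtain ⟨C, hC0, hC⟩ := hψ.exists_bound hxf ((hF1.mul hd1).add (hF2.mul hd2)) (by
        filter_upwards [hO.mem_nhds hx, hψ.eventually_isDefiningFunction] with y hy hyψ hyf
        exact hF.tangential y hyf hy ψ hyψ)
      obtain ⟨U, hU, hUo, hxU⟩ := eventually_nhds_iff.1 (hC.and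
        ((hF1.eventually (by simp)).and (hF2.eventually (by simp))))
      refine ⟨U, hUo, hxU, fun φ hφ hφ1 hs => ?_⟩
      have g1 := contDiff_mul_of_tsupport_subset hφ hs fun y hy => (hU y hy).2.1
      have g2 := contDiff_mul_of_tsupport_subset hφ hs fun y hy => (hU y hy).2.2
      have k1 : HasCompactSupport fun y => φ y * F₁ y := c₁.mul_left
      have k2 : HasCompactSupport fun y => φ y * F₂ y := c₂.mul_left
      refine ⟨(integrable_dvg g1 g2 k1 k2).integrableOn, ?_⟩
      rw [← integral_dvg_pos_set_eq_zero g1 g2 k1 k2 hψ.1 (C := C) ?_,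
        ← integral_indicator isClosed_closure.measurableSet.compl,
        ← integral_indicator (isOpen_lt continuous_const hψ.1.continuous).measurableSet]
      · congr 1
        ext y
        by_cases hy : y ∈ tsupport φ
        · have := (hU y (hs hy)).1.1
          by_cases hp : 0 < ψ y
          · rw [indicator_of_mem (by exact fun h => absurd (this.1 h) (not_le.2 hp)),
              indicator_of_mem (by exact hp)]
          · rw [indicator_of_notMem (by exact fun h => h (this.2 (not_lt.1 hp))),
              indicator_of_notMem (by exact hp)]
        · have := dvg_mul_eq_zero_of_notMem (F₁ := F₁) (F₂ := F₂) hy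
          simp only [indicator, this, ite_self]
      · intro y hp
        by_cases hy : y ∈ tsupport φ
        · have := (hU y (hs hy)).1.2 hp
          calc |φ y * F₁ y * d1 ψ y + φ y * F₂ y * d2 ψ y|
              = |φ y| * |F₁ y * d1 ψ y + F₂ y * d2 ψ y| := by rw [← abs_mul]; ring_nf
            _ ≤ 1 * (C * ψ y) := by gcongr; exact hφ1 y
            _ = C * ψ y := one_mul _
        · rw [image_eq_zero_of_notMem_tsupport hy]
          simp only [zero_mul, add_zero, abs_zero]
          positivity
  · refine ⟨O ∩ (closure H)ᶜ, hO.inter isClosed_closure.isOpen_compl, ⟨hx, hxc⟩,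
      fun φ hφ _ hs => ?_⟩
    have hsm : ∀ y ∈ O ∩ (closure H)ᶜ, ContDiffAt ℝ 1 F₁ y ∧ ContDiffAt ℝ 1 F₂ y := fun y hy =>
      hF.smooth y hy.1 fun h => hy.2 (subset_closure h)
    have g1 := contDiff_mul_of_tsupport_subset hφ hs fun y hy => (hsm y hy).1
    have g2 := contDiff_mul_of_tsupport_subset hφ hs fun y hy => (hsm y hy).2
    have k1 : HasCompactSupport fun y => φ y * F₁ y := c₁.mul_left
    have k2 : HasCompactSupport fun y => φ y * F₂ y := c₂.mul_left
    refine ⟨(integrable_dvg g1 g2 k1 k2).integrableOn, ?_⟩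
    rw [setIntegral_eq_integral_of_forall_compl_eq_zero, integral_dvg_eq_zero g1 g2 k1 k2]
    exact fun y hy => dvg_mul_eq_zero_of_notMem fun h => hy (hs h).2

lemma dvg_sum {ι : Type*} (t : Finset ι) {F₁ F₂ : ι → ℝ × ℝ → ℝ} {x : ℝ × ℝ}
    (h₁ : ∀ i ∈ t, DifferentiableAt ℝ (F₁ i) x) (h₂ : ∀ i ∈ t, DifferentiableAt ℝ (F₂ i) x) :
    dvg (fun y => ∑ i ∈ t, F₁ i y) (fun y => ∑ i ∈ t, F₂ i y) x
      = ∑ i ∈ t, dvg (F₁ i) (F₂ i) x := by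
  simp only [dvg, d1, d2]
  rw [fderiv_fun_sum h₁, fderiv_fun_sum h₂, Finset.sum_add_distrib]
  simp

/-- The divergence of a compactly supported field that is tangential to the boundary of the holes
has zero integral outside the holes. -/
lemma IsTangential.integral_dvg_eq_zero {H O : Set (ℝ × ℝ)} {F₁ F₂ : ℝ × ℝ → ℝ}
    (hF : IsTangential H O F₁ F₂) (hO : IsOpen O) (c₁ : HasCompactSupport F₁)
    (c₂ : HasCompactSupport F₂) (s₁ : tsupport F₁ ⊆ O) (s₂ : tsupport F₂ ⊆ O) :
    IntegrableOn (dvg F₁ F₂) (closure H)ᶜ ∧ ∫ y in (closure H)ᶜ, dvg F₁ F₂ y = 0 := by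
  -- On the compact union of the supports only finitely many members of the partition of unity are
  -- nonzero, so the field is a finite sum of localized pieces.
  choose U hUo hxU hU using fun x : O => hF.exists_local hO c₁ c₂ x.2
  set s := tsupport F₁ ∪ tsupport F₂ with hs
  have hsc : IsCompact s := c₁.isCompact.union c₂.isCompact
  have hsO : s ⊆ O := union_subset s₁ s₂
  obtain ⟨ρ, hρ⟩ := SmoothPartitionOfUnity.exists_isSubordinate
    (modelWithCornersSelf ℝ (ℝ × ℝ)) hsc.isClosed U hUo
    fun x hx => mem_iUnion.2 ⟨⟨x, hsO hx⟩, hxU _⟩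
  have hfin := ρ.locallyFinite.finite_nonempty_inter_compact hsc
  set t := hfin.toFinset with ht
  have hsum : ∀ y ∈ s, ∑ i ∈ t, ρ i y = 1 := by
    intro y hy
    rw [← ρ.sum_eq_one hy]
    symm
    apply finsum_eq_sum_of_support_subset
    intro i hi
    rw [ht, Finite.coe_toFinset]
    exact ⟨y, hi, hy⟩
  have hrep : ∀ F : ℝ × ℝ → ℝ, tsupport F ⊆ s → F = fun y => ∑ i ∈ t, ρ i y * F y := by
    intro F hFs
    ext y
    rw [← Finset.sum_mul]
    by_cases hy : y ∈ s
    · rw [hsum y hy, one_mul]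
    · rw [image_eq_zero_of_notMem_tsupport fun h => hy (hFs h), mul_zero]
  have hρs : ∀ i, ContDiff ℝ ∞ (ρ i) := fun i => (ρ i).contMDiff.contDiff
  have hdiff : ∀ y ∈ (closure H)ᶜ, DifferentiableAt ℝ F₁ y ∧ DifferentiableAt ℝ F₂ y := by
    intro y hy
    by_cases hyO : y ∈ O
    · have := hF.smooth y hyO fun h => hy (subset_closure h)
      exact ⟨this.1.differentiableAt (by simp), this.2.differentiableAt (by simp)⟩
    · exact ⟨(contDiffAt_of_notMem_tsupport (n := 1) fun h => hyO (s₁ h)).differentiableAt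
        (by simp), (contDiffAt_of_notMem_tsupport (n := 1) fun h => hyO (s₂ h)).differentiableAt
        (by simp)⟩
  have heq : EqOn (dvg F₁ F₂) (fun y => ∑ i ∈ t, dvg (fun y => ρ i y * F₁ y)
      (fun y => ρ i y * F₂ y) y) (closure H)ᶜ := by
    intro y hy
    conv_lhs => rw [hrep F₁ subset_union_left, hrep F₂ subset_union_right]
    exact dvg_sum t
      (fun i _ => ((hρs i).differentiable (by simp) y).mul (hdiff y hy).1)
      (fun i _ => ((hρs i).differentiable (by simp) y).mul (hdiff y hy).2)
  have hloc := fun i => hU i (ρ i) (hρs i)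
    (fun y => by rw [abs_of_nonneg (ρ.nonneg i y)]; exact ρ.le_one i y) (hρ i)
  have hm : MeasurableSet (closure H)ᶜ := isClosed_closure.measurableSet.compl
  refine ⟨IntegrableOn.congr_fun (integrable_finsetSum t fun i _ => (hloc i).1) heq.symm hm, ?_⟩
  rw [setIntegral_congr_fun hm heq, integral_finsetSum t fun i _ => (hloc i).1]
  exact Finset.sum_eq_zero fun i _ => (hloc i).2

/-! ### Sheared cells and their divergence theorem -/

/-- The part of the closed band `0 ≤ ξ₂ ≤ 1` between the interfaces shifted by `a` and `a + 1`. -/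
def shearedCell (ell : ℝ → ℝ) (a : ℝ) : Set (ℝ × ℝ) :=
  {x | a ≤ x.1 - ell x.2 ∧ x.1 - ell x.2 ≤ a + 1 ∧ 0 ≤ x.2 ∧ x.2 ≤ 1}

/-- The interior part of `shearedCell`. -/
def openShearedCell (ell : ℝ → ℝ) (a : ℝ) : Set (ℝ × ℝ) :=
  {x | a < x.1 - ell x.2 ∧ x.1 - ell x.2 < a + 1 ∧ 0 < x.2 ∧ x.2 < 1}

/-- The shear that straightens the interface. -/
def shear (ell : ℝ → ℝ) (p : ℝ × ℝ) : ℝ × ℝ := (p.1 + ell p.2, p.2)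

/-- The flux of `(F₁, F₂)` through the interface shifted by `a`. -/
noncomputable def flux (ell : ℝ → ℝ) (F₁ F₂ : ℝ × ℝ → ℝ) (a : ℝ) : ℝ :=
  ∫ t in (0 : ℝ)..1, (F₁ (a + ell t, t) - deriv ell t * F₂ (a + ell t, t))

/-- After exchanging the coordinates this is a skew product of translations. -/
lemma measurePreserving_shear {ell : ℝ → ℝ} (hell : Continuous ell) :
    MeasurePreserving (shear ell) := by
  have h : MeasurePreserving (fun p : ℝ × ℝ => (p.1, p.2 + ell p.1)) :=
    (MeasurePreserving.id volume).skew_product (g := fun t s => s + ell t)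
      (by
        have : Continuous (Function.uncurry fun t s => s + ell t) := by
          simp only [Function.uncurry_def]; fun_prop
        exact this.measurable)
      (Eventually.of_forall fun t => (measurePreserving_add_right volume (ell t)).map_eq)
  exact (Measure.measurePreserving_swap.comp h).comp Measure.measurePreserving_swap

lemma measurableEmbedding_shear {ell : ℝ → ℝ} (hell : Continuous ell) :
    MeasurableEmbedding (shear ell) := by
  let e : (ℝ × ℝ) ≃ₜ (ℝ × ℝ) :=
    { toFun := shear ell
      invFun := fun p => (p.1 - ell p.2, p.2)
      left_inv := fun p => by simp [shear]
      right_inv := fun p => by simp [shear]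
      continuous_toFun := by unfold shear; fun_prop
      continuous_invFun := by fun_prop }
  exact e.measurableEmbedding

lemma shear_preimage_shearedCell (ell : ℝ → ℝ) (a : ℝ) :
    shear ell ⁻¹' shearedCell ell a = Icc (a, 0) (a + 1, 1) := by
  ext p
  simp only [shear, shearedCell, mem_preimage, mem_ofPred_eq, add_sub_cancel_right, mem_Icc,
    Prod.le_def]
  tauto

lemma shear_image_Icc (ell : ℝ → ℝ) (a : ℝ) :
    shear ell '' Icc (a, 0) (a + 1, 1) = shearedCell ell a := by
  rw [← shear_preimage_shearedCell]
  apply image_preimage_eq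
  exact fun p => ⟨(p.1 - ell p.2, p.2), by simp [shear]⟩

lemma continuous_shear {ell : ℝ → ℝ} (hell : Continuous ell) : Continuous (shear ell) := by
  unfold shear; fun_prop

lemma isCompact_shearedCell {ell : ℝ → ℝ} (hell : Continuous ell) (a : ℝ) :
    IsCompact (shearedCell ell a) := by
  rw [← shear_image_Icc]
  exact isCompact_Icc.image (continuous_shear hell)

lemma isOpen_openShearedCell {ell : ℝ → ℝ} (hell : Continuous ell) (a : ℝ) :
    IsOpen (openShearedCell ell a) := by
  have h : Continuous fun x : ℝ × ℝ => x.1 - ell x.2 := by fun_prop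
  exact (isOpen_lt continuous_const h).inter ((isOpen_lt h continuous_const).inter
    ((isOpen_lt continuous_const continuous_snd).inter (isOpen_lt continuous_snd continuous_const)))

lemma openShearedCell_subset (ell : ℝ → ℝ) (a : ℝ) :
    openShearedCell ell a ⊆ shearedCell ell a := fun _ h =>
  ⟨h.1.le, h.2.1.le, h.2.2.1.le, h.2.2.2.le⟩

lemma setIntegral_shearedCell {ell : ℝ → ℝ} (hell : Continuous ell) (a : ℝ) (f : ℝ × ℝ → ℝ) :
    ∫ x in shearedCell ell a, f x = ∫ p in Icc (a, 0) (a + 1, 1), f (shear ell p) := by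
  rw [← (measurePreserving_shear hell).setIntegral_preimage_emb (measurableEmbedding_shear hell),
    shear_preimage_shearedCell]

lemma volume_shearedCell {ell : ℝ → ℝ} (hell : Continuous ell) (a : ℝ) :
    volume (shearedCell ell a) = 1 := by
  rw [← (measurePreserving_shear hell).measure_preimage
    (isCompact_shearedCell hell a).isClosed.measurableSet.nullMeasurableSet,
    shear_preimage_shearedCell, Icc_prod_eq, Measure.volume_eq_prod, Measure.prod_prod]
  simp

/-- The divergence theorem in a sheared cell without holes. -/
lemma setIntegral_dvg_shearedCell {ell : ℝ → ℝ} (hell : ContDiff ℝ 2 ell) {a : ℝ}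
    {F₁ F₂ : ℝ × ℝ → ℝ}
    (h₁ : ∀ x ∈ shearedCell ell a, ContDiffAt ℝ 1 F₁ x)
    (h₂ : ∀ x ∈ shearedCell ell a, ContDiffAt ℝ 1 F₂ x)
    (hper : ∀ s ∈ Icc a (a + 1), F₂ (s + ell 1, 1) = F₂ (s + ell 0, 0)) :
    ∫ x in shearedCell ell a, dvg F₁ F₂ x = flux ell F₁ F₂ (a + 1) - flux ell F₁ F₂ a := by
  have hc := hell.continuous
  rw [setIntegral_shearedCell hc]
  have hmem : ∀ p ∈ Icc (a, (0 : ℝ)) (a + 1, 1), shear ell p ∈ shearedCell ell a := by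
    intro p hp
    rwa [← shear_preimage_shearedCell ell] at hp
  have hell' : ContDiff ℝ 1 (deriv ell) := by
    have := contDiff_succ_iff_deriv.1 (show ContDiff ℝ (1 + 1) ell from hell)
    exact this.2.2
  have hT : ∀ p, HasFDerivAt (shear ell) ((ContinuousLinearMap.fst ℝ ℝ ℝ
      + deriv ell p.2 • ContinuousLinearMap.snd ℝ ℝ ℝ).prod (ContinuousLinearMap.snd ℝ ℝ ℝ)) p := by
    intro p
    have h1 : HasFDerivAt (fun p : ℝ × ℝ => ell p.2)
        (deriv ell p.2 • ContinuousLinearMap.snd ℝ ℝ ℝ) p :=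
      (hell.differentiable (by simp) p.2).hasDerivAt.comp_hasFDerivAt p hasFDerivAt_snd
    exact (hasFDerivAt_fst.add h1).prodMk hasFDerivAt_snd
  have hTs : ContDiff ℝ 1 (shear ell) := by
    unfold shear
    exact (contDiff_fst.add ((hell.of_le (by decide)).comp contDiff_snd)).prodMk contDiff_snd
  -- The Piola transform of the field under the shear. As the Jacobian is one, its divergence is the
  -- pulled-back divergence, and its first component is the flux density through the shifted
  -- interfaces.
  set W₁ : ℝ × ℝ → ℝ := fun p => F₁ (shear ell p) - deriv ell p.2 * F₂ (shear ell p) with hW₁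
  set W₂ : ℝ × ℝ → ℝ := fun p => F₂ (shear ell p) with hW₂
  have g₂ : ∀ p ∈ Icc (a, (0 : ℝ)) (a + 1, 1), ContDiffAt ℝ 1 W₂ p := fun p hp =>
    (h₂ _ (hmem p hp)).comp p hTs.contDiffAt
  have g₁ : ∀ p ∈ Icc (a, (0 : ℝ)) (a + 1, 1), ContDiffAt ℝ 1 W₁ p := fun p hp =>
    ((h₁ _ (hmem p hp)).comp p hTs.contDiffAt).sub
      ((hell'.comp contDiff_snd).contDiffAt.mul (g₂ p hp))
  have hdvg : ∀ p ∈ Icc (a, (0 : ℝ)) (a + 1, 1),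
      dvg F₁ F₂ (shear ell p) = fderiv ℝ W₁ p (1, 0) + fderiv ℝ W₂ p (0, 1) := by
    intro p hp
    have k1 := ((h₁ _ (hmem p hp)).differentiableAt (by simp)).hasFDerivAt.comp p (hT p)
    have k2 := ((h₂ _ (hmem p hp)).differentiableAt (by simp)).hasFDerivAt.comp p (hT p)
    have k3 : HasFDerivAt (fun p : ℝ × ℝ => deriv ell p.2)
        (deriv (deriv ell) p.2 • ContinuousLinearMap.snd ℝ ℝ ℝ) p :=
      (hell'.differentiable (by simp) p.2).hasDerivAt.comp_hasFDerivAt p hasFDerivAt_snd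
    have e1 : HasFDerivAt W₁ _ p := k1.sub (k3.mul k2)
    have e2 : HasFDerivAt W₂ _ p := k2
    rw [e1.fderiv, e2.fderiv]
    simp only [dvg, sub_apply, add_apply, smul_apply, ContinuousLinearMap.comp_apply,
      ContinuousLinearMap.prod_apply, ContinuousLinearMap.coe_fst', ContinuousLinearMap.coe_snd',
      smul_eq_mul, fderiv_apply_eq]
    ring
  have hint : IntegrableOn (fun p => fderiv ℝ W₁ p (1, 0) + fderiv ℝ W₂ p (0, 1))
      (Icc (a, (0 : ℝ)) (a + 1, 1)) := by
    apply ContinuousOn.integrableOn_compact isCompact_Icc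
    exact fun p hp => (continuousAt_dvg (g₁ p hp) (g₂ p hp)).continuousWithinAt
  rw [setIntegral_congr_fun measurableSet_Icc hdvg,
    integral_divergence_prod_Icc_of_hasFDerivAt_off_countable_of_le W₁ W₂ (fderiv ℝ W₁)
      (fderiv ℝ W₂) (a, 0) (a + 1, 1) ⟨by simp, by simp⟩ ∅ countable_empty
      (fun p hp => (g₁ p hp).continuousAt.continuousWithinAt)
      (fun p hp => (g₂ p hp).continuousAt.continuousWithinAt)
      (fun p hp => ((g₁ p ⟨⟨hp.1.1.1.le, hp.1.2.1.le⟩,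
        ⟨hp.1.1.2.le, hp.1.2.2.le⟩⟩).differentiableAt (by simp)).hasFDerivAt)
      (fun p hp => ((g₂ p ⟨⟨hp.1.1.1.le, hp.1.2.1.le⟩,
        ⟨hp.1.1.2.le, hp.1.2.2.le⟩⟩).differentiableAt (by simp)).hasFDerivAt) hint]
  have : ∫ x in a..a + 1, W₂ (x, 1) = ∫ x in a..a + 1, W₂ (x, 0) := by
    apply intervalIntegral.integral_congr
    intro s hs
    rw [uIcc_of_le (by simp)] at hs
    exact hper s hs
  simp only [this, sub_self, zero_add]
  rfl

/-- The divergence theorem in a perforated sheared cell for a field that is tangential to the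
boundaries of the holes. -/
lemma IsTangential.setIntegral_dvg {ell : ℝ → ℝ} (hell : ContDiff ℝ 2 ell) {a : ℝ}
    {H : Set (ℝ × ℝ)} {F₁ F₂ : ℝ × ℝ → ℝ}
    (hH : closure H ∩ shearedCell ell a ⊆ openShearedCell ell a)
    (hF : IsTangential H (openShearedCell ell a) F₁ F₂)
    (hs : ∀ x ∈ shearedCell ell a, x ∉ H → ContDiffAt ℝ 1 F₁ x ∧ ContDiffAt ℝ 1 F₂ x)
    (hper : ∀ s ∈ Icc a (a + 1), F₂ (s + ell 1, 1) = F₂ (s + ell 0, 0)) :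
    ∫ x in shearedCell ell a \ closure H, dvg F₁ F₂ x
      = flux ell F₁ F₂ (a + 1) - flux ell F₁ F₂ a := by
  have hc := hell.continuous
  have hQ := isCompact_shearedCell hc a
  have hO := isOpen_openShearedCell hc a
  have hK : IsCompact (closure H ∩ shearedCell ell a) := hQ.inter_left isClosed_closure
  -- Split `F = κF + (1 - κ)F` with `κ = 1` near the closed holes and support in the open cell. The
  -- first part integrates to zero; the second vanishes near the holes, so it is smooth on the full
  -- cell and has the edge fluxes of `F`.
  obtain ⟨K', hK', hKK', hK'O⟩ := exists_compact_between hK hO hH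
  obtain ⟨κ, hκ1, hκ0, -⟩ := exists_contMDiffMap_one_nhds_of_subset_interior
    (modelWithCornersSelf ℝ (ℝ × ℝ)) (n := ⊤) hK.isClosed hKK'
  have hκs : ContDiff ℝ ∞ κ := κ.contMDiff.contDiff
  have hκt : tsupport κ ⊆ K' := closure_minimal
    (fun x hx => by by_contra h; exact hx (hκ0 x h)) hK'.isClosed
  have hκc : HasCompactSupport κ := hK'.of_isClosed_subset (isClosed_tsupport _) hκt
  have hκx : ∀ x, ContDiffAt ℝ 1 κ x := fun x => (hκs.of_le (by simp)).contDiffAt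
  have hin : IsTangential H (openShearedCell ell a) (fun y => κ y * F₁ y)
      (fun y => κ y * F₂ y) :=
    { smooth := fun x hx hxH => ⟨(hκx x).mul (hF.smooth x hx hxH).1,
        (hκx x).mul (hF.smooth x hx hxH).2⟩
      smooth_boundary := hF.smooth_boundary
      tangential := fun x hx hxO ψ hψ => by
        have := hF.tangential x hx hxO ψ hψ
        linear_combination κ x * this }
  obtain ⟨i1, e1⟩ := hin.integral_dvg_eq_zero hO hκc.mul_right hκc.mul_right
    ((tsupport_mul_subset_left).trans (hκt.trans hK'O))
    ((tsupport_mul_subset_left).trans (hκt.trans hK'O))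
  set V₁ : ℝ × ℝ → ℝ := fun y => (1 - κ y) * F₁ y with hV₁
  set V₂ : ℝ × ℝ → ℝ := fun y => (1 - κ y) * F₂ y with hV₂
  have hV0 : ∀ x ∈ shearedCell ell a, x ∈ closure H → V₁ =ᶠ[𝓝 x] (fun _ => 0) ∧
      V₂ =ᶠ[𝓝 x] (fun _ => 0) := by
    intro x hx hxH
    have := eventually_nhdsSet_iff_forall.1 hκ1 x ⟨hxH, hx⟩
    constructor <;>
    · filter_upwards [this] with y hy
      simp [hV₁, hV₂, hy]
  have hVs : ∀ x ∈ shearedCell ell a, ContDiffAt ℝ 1 V₁ x ∧ ContDiffAt ℝ 1 V₂ x := by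
    intro x hx
    by_cases hxH : x ∈ H
    · have := hV0 x hx (subset_closure hxH)
      exact ⟨contDiffAt_const.congr_of_eventuallyEq this.1,
        contDiffAt_const.congr_of_eventuallyEq this.2⟩
    · have := hs x hx hxH
      exact ⟨(contDiffAt_const.sub (hκx x)).mul this.1, (contDiffAt_const.sub (hκx x)).mul this.2⟩
  have hb : ∀ x, x ∉ openShearedCell ell a → κ x = 0 := fun x hx => hκ0 x fun h => hx (hK'O h)
  have e2 := setIntegral_dvg_shearedCell hell (F₁ := V₁) (F₂ := V₂) (fun x hx => (hVs x hx).1)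
    (fun x hx => (hVs x hx).2) (fun s h => by
      simp only [hV₂]
      rw [hper s h, hb _ (fun h => lt_irrefl _ h.2.2.2), hb _ (fun h => lt_irrefl _ h.2.2.1)])
  have hflux : ∀ b, (b = a ∨ b = a + 1) → flux ell V₁ V₂ b = flux ell F₁ F₂ b := by
    intro b hb'
    unfold flux
    congr 1
    ext t
    have : κ (b + ell t, t) = 0 := by
      apply hb
      rintro ⟨h1, h2, -⟩
      simp only [add_sub_cancel_right] at h1 h2
      rcases hb' with rfl | rfl
      · exact lt_irrefl _ h1
      · exact lt_irrefl _ h2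
    simp only [hV₁, hV₂, this, sub_zero, one_mul]
  rw [hflux _ (Or.inl rfl), hflux _ (Or.inr rfl)] at e2
  rw [← e2]
  have hm : MeasurableSet (shearedCell ell a) := hQ.isClosed.measurableSet
  have hmc : MeasurableSet (closure H) := isClosed_closure.measurableSet
  have i2 : IntegrableOn (dvg V₁ V₂) (shearedCell ell a) :=
    ContinuousOn.integrableOn_compact hQ fun x hx =>
      (continuousAt_dvg (hVs x hx).1 (hVs x hx).2).continuousWithinAt
  have e3 : ∫ x in shearedCell ell a \ closure H,
      dvg (fun y => κ y * F₁ y) (fun y => κ y * F₂ y) x = 0 := by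
    rw [← e1]
    symm
    refine setIntegral_eq_of_subset_of_forall_sdiff_eq_zero hmc.compl
      (fun x hx h => hx.2 h) fun x hx => ?_
    apply dvg_mul_eq_zero_of_notMem
    intro h
    exact hx.2 ⟨openShearedCell_subset ell a (hK'O (hκt h)), fun h' => hx.1 h'⟩
  have e4 : ∫ x in shearedCell ell a \ closure H, dvg V₁ V₂ x
      = ∫ x in shearedCell ell a, dvg V₁ V₂ x := by
    symm
    refine setIntegral_eq_of_subset_of_forall_sdiff_eq_zero hm sdiff_subset fun x hx => ?_
    have hxc : x ∈ closure H := by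
      by_contra h
      exact hx.2 ⟨hx.1, h⟩
    rw [dvg_congr (hV0 x hx.1 hxc).1 (hV0 x hx.1 hxc).2, dvg_zero]
  rw [← e4, ← zero_add (∫ x in shearedCell ell a \ closure H, dvg V₁ V₂ x), ← e3,
    ← integral_add (i1.mono_set fun x hx h => hx.2 h) (i2.mono_set sdiff_subset)]
  refine setIntegral_congr_fun (hm.diff hmc) fun x hx => ?_
  have hsx := hs x hx.1 fun h => hx.2 (subset_closure h)
  have f1 := hsx.1.differentiableAt (by simp)
  have f2 := hsx.2.differentiableAt (by simp)
  have fκ := (hκx x).differentiableAt (by simp)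
  have fκ' : DifferentiableAt ℝ (fun y => 1 - κ y) x := fκ.const_sub 1
  rw [hV₁, hV₂, dvg_smul fκ f1 f2, dvg_smul fκ' f1 f2]
  simp only [d1, d2, fderiv_const_sub, neg_apply]
  ring

/-! ### The periodic array of holes -/

lemma IsHoleSystem.isOpen {G : Set (ℝ × ℝ)} (hG : IsHoleSystem G) : IsOpen G := by
  obtain ⟨m, D, h1, -, -, rfl⟩ := hG
  exact isOpen_iUnion fun i => (h1 i).isOpen

lemma IsHoleSystem.closure_subset {G : Set (ℝ × ℝ)} (hG : IsHoleSystem G) :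
    closure G ⊆ Ioo (0 : ℝ) 1 ×ˢ Ioo (0 : ℝ) 1 := by
  obtain ⟨m, D, -, -, h3, rfl⟩ := hG
  rw [closure_iUnion_of_finite]
  exact iUnion_subset h3

lemma IsHoleSystem.smooth_boundary {G : Set (ℝ × ℝ)} (hG : IsHoleSystem G) {x : ℝ × ℝ}
    (hx : x ∈ frontier G) : ∃ ψ, IsDefiningFunction G x ψ := by
  have hxG : x ∉ G := by rw [hG.isOpen.frontier_eq] at hx; exact hx.2
  obtain ⟨m, D, h1, h2, -, rfl⟩ := hG
  have hxc := hx.1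
  rw [closure_iUnion_of_finite, mem_iUnion] at hxc
  obtain ⟨i, hi⟩ := hxc
  have hxf : x ∈ frontier (D i) := by
    rw [(h1 i).isOpen.frontier_eq]
    exact ⟨hi, fun h => hxG (mem_iUnion.2 ⟨i, h⟩)⟩
  obtain ⟨ψ, hs, hd, he⟩ := (h1 i).smooth_boundary x hxf
  refine ⟨ψ, hs, hd, ?_⟩
  -- The other closed holes are finitely many and miss `x`, so near `x` the union is `D i` alone.
  have hoth : ∀ᶠ y in 𝓝 x, ∀ j, j ≠ i → y ∉ closure (D j) := by
    rw [eventually_all]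
    intro j
    by_cases hj : j = i
    · exact Eventually.of_forall fun y h => absurd hj h
    · have hxj : x ∉ closure (D j) := fun h => disjoint_left.1 (h2 j i hj) h hi
      filter_upwards [isClosed_closure.isOpen_compl.mem_nhds hxj] with y hy _
      exact hy
  filter_upwards [he, hoth] with y h3 h4
  rw [← h3, mem_iUnion]
  refine ⟨fun ⟨j, hj⟩ => ?_, fun h => ⟨i, h⟩⟩
  by_cases hji : j = i
  · exact hji ▸ hj
  · exact absurd (subset_closure hj) (h4 j hji)

lemma periodicHoles_eq_iUnion (G : Set (ℝ × ℝ)) :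
    periodicHoles G = ⋃ k : ℤ × ℤ, (Homeomorph.addRight (-((k.1 : ℝ), (k.2 : ℝ)))) ⁻¹' G := by
  ext x
  simp only [periodicHoles, mem_ofPred_eq, mem_iUnion, Prod.exists, mem_preimage,
    Homeomorph.coe_addRight]
  rfl

lemma IsHoleSystem.isOpen_periodicHoles {G : Set (ℝ × ℝ)} (hG : IsHoleSystem G) :
    IsOpen (periodicHoles G) := by
  rw [periodicHoles_eq_iUnion]
  exact isOpen_iUnion fun k => hG.isOpen.preimage (Homeomorph.continuous _)

/-- The translates form a locally finite family, so closure commutes with their union. -/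
lemma IsHoleSystem.mem_closure_periodicHoles {G : Set (ℝ × ℝ)} (hG : IsHoleSystem G)
    {x : ℝ × ℝ} :
    x ∈ closure (periodicHoles G) ↔ ∃ k n : ℤ, (x.1 - k, x.2 - n) ∈ closure G := by
  have hlf : LocallyFinite fun k : ℤ × ℤ =>
      (Homeomorph.addRight (-((k.1 : ℝ), (k.2 : ℝ)))) ⁻¹' G := by
    intro x
    refine ⟨Metric.ball x 1, Metric.ball_mem_nhds x one_pos,
      ((finite_Icc (⌊x.1⌋ - 2) (⌊x.1⌋ + 2)).prod
        (finite_Icc (⌊x.2⌋ - 2) (⌊x.2⌋ + 2))).subset ?_⟩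
    rintro ⟨k, n⟩ ⟨y, hy, hyb⟩
    have hy' : (y.1 - k, y.2 - n) ∈ G := hy
    have := hG.closure_subset (subset_closure hy')
    obtain ⟨⟨a1, a2⟩, b1, b2⟩ := this
    simp only at a1 a2 b1 b2
    rw [Metric.mem_ball, Prod.dist_eq, max_lt_iff, Real.dist_eq, Real.dist_eq, abs_lt, abs_lt] at hyb
    have c1 := Int.floor_le x.1
    have c2 := Int.lt_floor_add_one x.1
    have d1 := Int.floor_le x.2
    have d2 := Int.lt_floor_add_one x.2
    obtain ⟨⟨e1, e2⟩, e3, e4⟩ := hyb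
    simp only [mem_prod, mem_Icc]
    refine ⟨⟨?_, ?_⟩, ?_, ?_⟩ <;> rw [← Int.cast_le (R := ℝ)] <;> push_cast <;> linarith
  rw [periodicHoles_eq_iUnion, hlf.closure_iUnion]
  rw [mem_iUnion, Prod.exists]
  simp_rw [← Homeomorph.preimage_closure]
  rfl

lemma mem_periodicHoles_add {G : Set (ℝ × ℝ)} (x : ℝ × ℝ) (k n : ℤ) :
    (x.1 + k, x.2 + n) ∈ periodicHoles G ↔ x ∈ periodicHoles G := by
  constructor
  · rintro ⟨a, b, h⟩
    refine ⟨a - k, b - n, ?_⟩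
    convert h using 2 <;> push_cast <;> ring
  · rintro ⟨a, b, h⟩
    refine ⟨a + k, b + n, ?_⟩
    convert h using 2 <;> push_cast <;> ring

lemma preimage_add_periodicHoles (G : Set (ℝ × ℝ)) (k n : ℤ) :
    (Homeomorph.addRight ((k : ℝ), (n : ℝ))) ⁻¹' periodicHoles G = periodicHoles G := by
  ext x
  exact mem_periodicHoles_add x k n

lemma mem_closure_periodicHoles_add {G : Set (ℝ × ℝ)} (x : ℝ × ℝ) (k n : ℤ) :
    (x.1 + k, x.2 + n) ∈ closure (periodicHoles G) ↔ x ∈ closure (periodicHoles G) := by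
  conv_rhs => rw [← preimage_add_periodicHoles G k n, ← Homeomorph.preimage_closure]
  rfl

lemma IsHoleSystem.mem_periodicHoles_iff {G : Set (ℝ × ℝ)} (hG : IsHoleSystem G) {x : ℝ × ℝ}
    (hx : x ∈ Icc (0 : ℝ) 1 ×ˢ Icc (0 : ℝ) 1) : x ∈ periodicHoles G ↔ x ∈ G := by
  refine ⟨?_, fun h => ⟨0, 0, by simpa using h⟩⟩
  rintro ⟨k, n, h⟩
  obtain ⟨⟨a1, a2⟩, b1, b2⟩ := hG.closure_subset (subset_closure h)
  obtain ⟨⟨c1, c2⟩, c3, c4⟩ := hx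
  simp only at a1 a2 b1 b2
  have hk : k = 0 := by
    have h1 : (k : ℝ) < 1 := by linarith
    have h2 : (-1 : ℝ) < k := by linarith
    norm_cast at h1 h2; omega
  have hn : n = 0 := by
    have h1 : (n : ℝ) < 1 := by linarith
    have h2 : (-1 : ℝ) < n := by linarith
    norm_cast at h1 h2; omega
  simpa [hk, hn] using h

lemma IsHoleSystem.mem_closure_periodicHoles_iff {G : Set (ℝ × ℝ)} (hG : IsHoleSystem G)
    {x : ℝ × ℝ} (hx : x ∈ Icc (0 : ℝ) 1 ×ˢ Icc (0 : ℝ) 1) :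
    x ∈ closure (periodicHoles G) ↔ x ∈ closure G := by
  rw [hG.mem_closure_periodicHoles]
  refine ⟨?_, fun h => ⟨0, 0, by simpa using h⟩⟩
  rintro ⟨k, n, h⟩
  obtain ⟨⟨a1, a2⟩, b1, b2⟩ := hG.closure_subset h
  obtain ⟨⟨c1, c2⟩, c3, c4⟩ := hx
  simp only at a1 a2 b1 b2
  have hk : k = 0 := by
    have h1 : (k : ℝ) < 1 := by linarith
    have h2 : (-1 : ℝ) < k := by linarith
    norm_cast at h1 h2; omega
  have hn : n = 0 := by
    have h1 : (n : ℝ) < 1 := by linarith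
    have h2 : (-1 : ℝ) < n := by linarith
    norm_cast at h1 h2; omega
  simpa [hk, hn] using h

lemma IsHoleSystem.cell_eq {G : Set (ℝ × ℝ)} (hG : IsHoleSystem G) :
    cell G = (Icc (0 : ℝ) 1 ×ˢ Icc (0 : ℝ) 1) \ closure (periodicHoles G) := by
  ext x
  constructor
  · rintro ⟨h1, h2⟩
    exact ⟨h1, fun h => h2 ((hG.mem_closure_periodicHoles_iff h1).1 h)⟩
  · rintro ⟨h1, h2⟩
    exact ⟨h1, fun h => h2 ((hG.mem_closure_periodicHoles_iff h1).2 h)⟩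

/-- Each closed hole lies in an open unit square with integer corners. -/
lemma IsHoleSystem.snd_ne_int {G : Set (ℝ × ℝ)} (hG : IsHoleSystem G) {x : ℝ × ℝ}
    (hx : x ∈ closure (periodicHoles G)) (n : ℤ) : x.2 ≠ n := by
  intro h
  obtain ⟨k, m, hm⟩ := hG.mem_closure_periodicHoles.1 hx
  obtain ⟨-, b1, b2⟩ := hG.closure_subset hm
  simp only at b1 b2
  rw [h] at b1 b2
  have h1 : (m : ℝ) < n := by linarith
  have h2 : (n : ℝ) < m + 1 := by linarith
  norm_cast at h1 h2; omega

/-- Every smooth boundary point of the periodic holes is a translate of one of the basic holes. -/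
lemma IsHoleSystem.exists_shift {G : Set (ℝ × ℝ)} (hG : IsHoleSystem G) {x : ℝ × ℝ}
    (hx : x ∈ frontier (periodicHoles G)) :
    ∃ k n : ℤ, (x.1 - k, x.2 - n) ∈ frontier G ∧
      ∀ᶠ y : ℝ × ℝ in 𝓝 (x.1 - (k : ℝ), x.2 - (n : ℝ)), (y.1 + k, y.2 + n) ∈ periodicHoles G ↔ y ∈ G := by
  have hx' := hx
  rw [hG.isOpen_periodicHoles.frontier_eq] at hx'
  obtain ⟨k, n, h⟩ := hG.mem_closure_periodicHoles.1 hx'.1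
  refine ⟨k, n, ?_, ?_⟩
  · rw [hG.isOpen.frontier_eq]
    exact ⟨h, fun h' => hx'.2 ⟨k, n, h'⟩⟩
  · filter_upwards [(isOpen_Ioo.prod isOpen_Ioo).mem_nhds (hG.closure_subset h)] with y hy
    rw [mem_periodicHoles_add, hG.mem_periodicHoles_iff
      ⟨Ioo_subset_Icc_self hy.1, Ioo_subset_Icc_self hy.2⟩]

lemma fderiv_shift (ψ : ℝ × ℝ → ℝ) (v x : ℝ × ℝ) :
    fderiv ℝ (fun y => ψ (y + v)) x = fderiv ℝ ψ (x + v) :=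
  fderiv_comp_add_right v

lemma IsDefiningFunction.shift {S T : Set (ℝ × ℝ)} {x v : ℝ × ℝ} {ψ : ℝ × ℝ → ℝ}
    (h : IsDefiningFunction S (x + v) ψ) (hST : ∀ᶠ y in 𝓝 x, (y + v ∈ S ↔ y ∈ T)) :
    IsDefiningFunction T x fun y => ψ (y + v) := by
  obtain ⟨hs, hd, he⟩ := h
  refine ⟨hs.comp (contDiff_id.add contDiff_const), by rwa [fderiv_shift], ?_⟩
  have ht : Tendsto (fun y => y + v) (𝓝 x) (𝓝 (x + v)) :=
    (continuous_id.add continuous_const).tendsto x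
  filter_upwards [hST, ht.eventually he] with y h1 h2
  rw [← h1, h2]

lemma IsHoleSystem.smooth_boundary_periodicHoles {G : Set (ℝ × ℝ)} (hG : IsHoleSystem G)
    {x : ℝ × ℝ} (hx : x ∈ frontier (periodicHoles G)) :
    ∃ ψ, IsDefiningFunction (periodicHoles G) x ψ := by
  obtain ⟨k, n, h1, h2⟩ := hG.exists_shift hx
  obtain ⟨ψ, hψ⟩ := hG.smooth_boundary h1
  refine ⟨_, IsDefiningFunction.shift (S := G) (v := (-(k : ℝ), -(n : ℝ))) (ψ := ψ) ?_ ?_⟩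
  · have hxv : x + (-(k : ℝ), -(n : ℝ)) = (x.1 - k, x.2 - n) := by
      ext <;> simp [sub_eq_add_neg]
    rwa [hxv]
  · have ht : Tendsto (fun y : ℝ × ℝ => (y.1 - k, y.2 - n)) (𝓝 x) (𝓝 (x.1 - k, x.2 - n)) := by
      have : Continuous fun y : ℝ × ℝ => (y.1 - (k : ℝ), y.2 - (n : ℝ)) := by fun_prop
      exact this.tendsto x
    filter_upwards [ht.eventually h2] with y hy
    simp only [sub_add_cancel] at hy
    have hyv : y + (-(k : ℝ), -(n : ℝ)) = (y.1 - k, y.2 - n) := by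
      ext <;> simp [sub_eq_add_neg]
    rw [hyv]
    exact hy.symm

/-- Carries the Neumann condition, assumed only on the basic holes, to all translates. -/
lemma IsHoleSystem.isUnitNormalInto_shift {G : Set (ℝ × ℝ)} (hG : IsHoleSystem G) {x : ℝ × ℝ}
    (hx : x ∈ frontier (periodicHoles G)) :
    ∃ k n : ℤ, (x.1 - k, x.2 - n) ∈ frontier G ∧
      ∀ ν, IsUnitNormalInto (periodicHoles G) x ν → IsUnitNormalInto G (x.1 - k, x.2 - n) ν := by
  obtain ⟨k, n, h1, h2⟩ := hG.exists_shift hx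
  refine ⟨k, n, h1, ?_⟩
  rintro ν ⟨hν, ψ, hψ, t, ht, e1, e2⟩
  have hxv : (x.1 - (k : ℝ), x.2 - (n : ℝ)) + ((k : ℝ), (n : ℝ)) = x := by simp
  refine ⟨hν, _, IsDefiningFunction.shift (v := ((k : ℝ), (n : ℝ))) (ψ := ψ) (by rwa [hxv]) h2,
    t, ht, ?_, ?_⟩
  · simp only [d1, fderiv_shift, hxv]; exact e1
  · simp only [d2, fderiv_shift, hxv]; exact e2

/-- The normal is `-∇ψ/|∇ψ|`, with `t = |∇ψ|`. It converts conditions on unit normals into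
conditions on `∇ψ` for an arbitrary defining function. -/
lemma IsDefiningFunction.exists_isUnitNormalInto {S : Set (ℝ × ℝ)} {x : ℝ × ℝ} {ψ : ℝ × ℝ → ℝ}
    (h : IsDefiningFunction S x ψ) :
    ∃ ν t, IsUnitNormalInto S x ν ∧ d1 ψ x = -t * ν.1 ∧ d2 ψ x = -t * ν.2 := by
  set t := √(d1 ψ x ^ 2 + d2 ψ x ^ 2) with ht
  have hpos : 0 < d1 ψ x ^ 2 + d2 ψ x ^ 2 := by
    by_contra! hcon
    have a1 : d1 ψ x = 0 := by nlinarith [sq_nonneg (d1 ψ x), sq_nonneg (d2 ψ x)]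
    have a2 : d2 ψ x = 0 := by nlinarith [sq_nonneg (d1 ψ x), sq_nonneg (d2 ψ x)]
    apply h.2.1
    ext <;> simp [fderiv_apply_eq, a1, a2]
  have ht0 : 0 < t := Real.sqrt_pos.2 hpos
  have ht2 : t ^ 2 = d1 ψ x ^ 2 + d2 ψ x ^ 2 := Real.sq_sqrt hpos.le
  refine ⟨(-d1 ψ x / t, -d2 ψ x / t), t, ⟨?_, ψ, h, t, ht0, ?_, ?_⟩, ?_, ?_⟩ <;> field_simp
  rw [ht2]

/-! ### The interface and the holes -/

/-- The shifted interfaces do not meet the closed holes. -/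
lemma IsInterfaceProfile.notMem_closure {G : Set (ℝ × ℝ)} {ell : ℝ → ℝ}
    (hell : IsInterfaceProfile G ell) (hG : IsHoleSystem G) (a : ℤ) (t : ℝ) :
    ((a : ℝ) + ell t, t) ∉ closure (periodicHoles G) := by
  have hc : Continuous fun t => (ell t, t) := hell.smooth.continuous.prodMk continuous_id
  have hcl : ∀ t, (ell t, t) ∈ closure (periodicHoles G) → (ell t, t) ∈ periodicHoles G := by
    intro t ht
    by_contra hcon
    apply hell.avoids_holes t
    rw [hG.isOpen_periodicHoles.frontier_eq]
    exact ⟨ht, hcon⟩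
  -- Avoiding the boundary makes the set of parameters inside holes clopen, hence empty or all of
  -- `ℝ`; it omits `t = 0`, since no hole meets the line `ξ₂ = 0`.
  have hclopen : IsClopen ((fun t => (ell t, t)) ⁻¹' periodicHoles G) := by
    refine ⟨?_, hG.isOpen_periodicHoles.preimage hc⟩
    have : (fun t => (ell t, t)) ⁻¹' periodicHoles G
        = (fun t => (ell t, t)) ⁻¹' closure (periodicHoles G) :=
      Subset.antisymm (fun t ht => subset_closure ht) fun t ht => hcl t ht
    rw [this]
    exact isClosed_closure.preimage hc
  have hempty : (fun t => (ell t, t)) ⁻¹' periodicHoles G = ∅ := by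
    rcases isClopen_iff.1 hclopen with h | h
    · exact h
    · exfalso
      have h0 : (0 : ℝ) ∈ (fun t => (ell t, t)) ⁻¹' periodicHoles G := h ▸ mem_univ _
      exact hG.snd_ne_int (subset_closure h0) 0 (by simp)
  intro h
  have h' : (ell t, t) ∈ closure (periodicHoles G) := by
    rw [← mem_closure_periodicHoles_add (ell t, t) a 0]
    simpa [add_comm] using h
  have : t ∈ (fun t => (ell t, t)) ⁻¹' periodicHoles G := hcl t h'
  rw [hempty] at this
  exact this

lemma IsInterfaceProfile.closure_inter_shearedCell {G : Set (ℝ × ℝ)} {ell : ℝ → ℝ}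
    (hell : IsInterfaceProfile G ell) (hG : IsHoleSystem G) (a : ℤ) :
    closure (periodicHoles G) ∩ shearedCell ell a ⊆ openShearedCell ell a := by
  rintro x ⟨hx, h1, h2, h3, h4⟩
  have key : ∀ b : ℤ, x.1 - ell x.2 ≠ b := by
    intro b hb
    apply hell.notMem_closure hG b x.2
    rwa [← hb, sub_add_cancel]
  refine ⟨lt_of_le_of_ne h1 (key a).symm, lt_of_le_of_ne h2 ?_, lt_of_le_of_ne h3 ?_,
    lt_of_le_of_ne h4 ?_⟩
  · simpa using key (a + 1)
  · simpa using (hG.snd_ne_int hx 0).symm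
  · simpa using hG.snd_ne_int hx 1

/-! ### Periodicity of derivatives -/

lemma apply_add_intCast {N : ℝ × ℝ → ℝ} (h₁ : ∀ x : ℝ × ℝ, N (x.1 + 1, x.2) = N x)
    (h₂ : ∀ x : ℝ × ℝ, N (x.1, x.2 + 1) = N x) (x : ℝ × ℝ) (k n : ℤ) :
    N (x + ((k : ℝ), (n : ℝ))) = N x := by
  have p1 : ∀ t, Function.Periodic (fun s => N (s, t)) 1 := fun t s => h₁ (s, t)
  have p2 : ∀ s, Function.Periodic (fun t => N (s, t)) 1 := fun s t => h₂ (s, t)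
  have q1 := (p1 (x.2 + n)).int_mul k x.1
  have q2 := (p2 x.1).int_mul n x.2
  simp only [mul_one] at q1 q2
  exact q1.trans q2

lemma fderiv_eq_of_shift {N : ℝ × ℝ → ℝ} {v : ℝ × ℝ} (h : ∀ x, N (x + v) = N x) (x : ℝ × ℝ) :
    fderiv ℝ N (x + v) = fderiv ℝ N x := by
  rw [← fderiv_shift]
  simp_rw [h]

lemma d1_eq_of_shift {N : ℝ × ℝ → ℝ} {v : ℝ × ℝ} (h : ∀ x, N (x + v) = N x) (x : ℝ × ℝ) :
    d1 N (x + v) = d1 N x := by simp only [d1, fderiv_eq_of_shift h]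

lemma d2_eq_of_shift {N : ℝ × ℝ → ℝ} {v : ℝ × ℝ} (h : ∀ x, N (x + v) = N x) (x : ℝ × ℝ) :
    d2 N (x + v) = d2 N x := by simp only [d2, fderiv_eq_of_shift h]

lemma lap_eq_of_shift {N : ℝ × ℝ → ℝ} {v : ℝ × ℝ} (h : ∀ x, N (x + v) = N x) (x : ℝ × ℝ) :
    lap N (x + v) = lap N x := by
  simp only [lap, d1_eq_of_shift (d1_eq_of_shift h), d2_eq_of_shift (d2_eq_of_shift h)]

/-! ### Green's formula and the Caccioppoli bound for the flux -/

lemma openShearedCell_ae_eq {ell : ℝ → ℝ} (hell : Continuous ell) (a : ℝ) :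
    openShearedCell ell a =ᵐ[volume] shearedCell ell a := by
  have hpre : shear ell ⁻¹' openShearedCell ell a = Ioo a (a + 1) ×ˢ Ioo (0 : ℝ) 1 := by
    ext p
    simp only [shear, openShearedCell, mem_preimage, mem_ofPred_eq, add_sub_cancel_right, mem_prod,
      mem_Ioo]
    tauto
  have hm := (isOpen_openShearedCell hell a).measurableSet
  refine ae_eq_of_subset_of_measure_ge (openShearedCell_subset ell a) ?_ hm.nullMeasurableSet ?_
  · rw [volume_shearedCell hell,
      ← (measurePreserving_shear hell).measure_preimage hm.nullMeasurableSet, hpre,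
      Measure.volume_eq_prod, Measure.prod_prod]
    simp
  · rw [volume_shearedCell hell]; simp

lemma setIntegral_shearedCell_diff {ell : ℝ → ℝ} (hell : Continuous ell) (a : ℝ)
    (S : Set (ℝ × ℝ)) (f : ℝ × ℝ → ℝ) :
    ∫ x in shearedCell ell a \ S, f x = ∫ x in openShearedCell ell a \ S, f x :=
  setIntegral_congr_set ((openShearedCell_ae_eq hell a).diff (ae_eq_refl S)).symm

/-- `B` is harmonic in a perforated sheared cell, with zero normal derivative on the boundaries of
the holes `H`, and periodic in the second variable. -/
structure IsCellHarmonic (H : Set (ℝ × ℝ)) (ell : ℝ → ℝ) (a : ℝ) (B : ℝ × ℝ → ℝ) : Prop where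
  inter_subset : closure H ∩ shearedCell ell a ⊆ openShearedCell ell a
  smooth : ∀ x ∈ shearedCell ell a, x ∉ H → ContDiffAt ℝ 2 B x
  periodic : ∀ x : ℝ × ℝ, B (x.1, x.2 + 1) = B x
  harmonic : ∀ x ∈ openShearedCell ell a, x ∉ closure H → lap B x = 0
  smooth_boundary : ∀ x ∈ frontier H, x ∈ openShearedCell ell a → ∃ ψ, IsDefiningFunction H x ψ
  neumann : ∀ x ∈ frontier H, x ∈ openShearedCell ell a → ∀ ψ, IsDefiningFunction H x ψ →
    d1 B x * d1 ψ x + d2 B x * d2 ψ x = 0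

lemma IsCellHarmonic.d2_periodic {H : Set (ℝ × ℝ)} {ell : ℝ → ℝ} {a : ℝ} {B : ℝ × ℝ → ℝ}
    (hB : IsCellHarmonic H ell a B) (s : ℝ) : d2 B (s, 1) = d2 B (s, 0) := by
  have h : ∀ x : ℝ × ℝ, B (x + (0, 1)) = B x := fun x => by
    rw [← hB.periodic x]; congr 1; ext <;> simp
  simpa using d2_eq_of_shift h (s, 0)

lemma IsCellHarmonic.smooth_mul {H : Set (ℝ × ℝ)} {ell : ℝ → ℝ} {a : ℝ} {B w : ℝ × ℝ → ℝ}
    (hB : IsCellHarmonic H ell a B) (hw : ∀ x ∈ shearedCell ell a, x ∉ H → ContDiffAt ℝ 1 w x)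
    (x : ℝ × ℝ) (hx : x ∈ shearedCell ell a) (hxH : x ∉ H) :
    ContDiffAt ℝ 1 (fun y => w y * d1 B y) x ∧ ContDiffAt ℝ 1 (fun y => w y * d2 B y) x :=
  ⟨(hw x hx hxH).mul (contDiffAt_d1 (hB.smooth x hx hxH) (by norm_num)),
    (hw x hx hxH).mul (contDiffAt_d2 (hB.smooth x hx hxH) (by norm_num))⟩

/-- Green's formula for `∇w · ∇B` in a perforated sheared cell. -/
lemma IsCellHarmonic.setIntegral_grad {H : Set (ℝ × ℝ)} {ell : ℝ → ℝ} {a : ℝ} {B w : ℝ × ℝ → ℝ}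
    (hB : IsCellHarmonic H ell a B) (hell : ContDiff ℝ 2 ell) (hell1 : ell 1 = ell 0)
    (hw : ∀ x ∈ shearedCell ell a, x ∉ H → ContDiffAt ℝ 1 w x)
    (hwper : ∀ s, w (s + ell 0, 1) = w (s + ell 0, 0)) :
    ∫ x in openShearedCell ell a \ closure H, (d1 w x * d1 B x + d2 w x * d2 B x)
      = flux ell (fun y => w y * d1 B y) (fun y => w y * d2 B y) (a + 1)
        - flux ell (fun y => w y * d1 B y) (fun y => w y * d2 B y) a := by
  have ht : IsTangential H (openShearedCell ell a) (fun y => w y * d1 B y)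
      (fun y => w y * d2 B y) :=
    { smooth := fun x hx hxH => hB.smooth_mul hw x (openShearedCell_subset ell a hx) hxH
      smooth_boundary := hB.smooth_boundary
      tangential := fun x hx hxO ψ hψ => by
        have := hB.neumann x hx hxO ψ hψ
        linear_combination w x * this }
  rw [← ht.setIntegral_dvg hell hB.inter_subset (hB.smooth_mul hw)
    (fun s _ => by rw [hell1, hwper, hB.d2_periodic]), setIntegral_shearedCell_diff hell.continuous]
  refine setIntegral_congr_fun ((isOpen_openShearedCell hell.continuous a).measurableSet.diff
    isClosed_closure.measurableSet) fun x hx => ?_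
  have hxQ := openShearedCell_subset ell a hx.1
  have hxH : x ∉ H := fun h => hx.2 (subset_closure h)
  have hs := hB.smooth x hxQ hxH
  have hlap : dvg (d1 B) (d2 B) x = 0 := hB.harmonic x hx.1 hx.2
  rw [dvg_smul ((hw x hxQ hxH).differentiableAt (by simp))
    ((contDiffAt_d1 (m := 1) hs (by norm_num)).differentiableAt (by simp))
    ((contDiffAt_d2 (m := 1) hs (by norm_num)).differentiableAt (by simp)), hlap]
  ring

/-- Green's formula with `w = 1`: conservation of flux. -/
lemma IsCellHarmonic.flux_succ {H : Set (ℝ × ℝ)} {ell : ℝ → ℝ} {a : ℝ} {B : ℝ × ℝ → ℝ}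
    (hB : IsCellHarmonic H ell a B) (hell : ContDiff ℝ 2 ell) (hell1 : ell 1 = ell 0) :
    flux ell (d1 B) (d2 B) (a + 1) = flux ell (d1 B) (d2 B) a := by
  have := hB.setIntegral_grad (w := fun _ => 1) hell hell1 (fun _ _ _ => contDiffAt_const)
    fun _ => rfl
  simp only [one_mul] at this
  rw [← sub_eq_zero, ← this]
  simp [d1, d2]

/-- Integrability is not required: a non-integrable function has integral `0 ≤ K` by convention. -/
lemma setIntegral_le_of_forall_le {S : Set (ℝ × ℝ)} (hS : MeasurableSet S) (hv : volume S ≤ 1)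
    {f : ℝ × ℝ → ℝ} {K : ℝ} (hK : 0 ≤ K) (hf : ∀ x ∈ S, f x ≤ K) : ∫ x in S, f x ≤ K := by
  by_cases hi : IntegrableOn f S
  · have hfin : volume S ≠ ⊤ := (hv.trans_lt ENNReal.one_lt_top).ne
    calc ∫ x in S, f x ≤ ∫ _ in S, K :=
          setIntegral_mono_on hi (integrableOn_const hfin) hS hf
      _ = volume.real S * K := by simp
      _ ≤ 1 * K := by
          gcongr
          exact ENNReal.toReal_le_of_le_ofReal zero_le_one (by simpa using hv)
      _ = K := one_mul K
  · rw [integral_undef hi]; exact hK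

/-- The pointwise inequality behind the Caccioppoli estimate. -/
lemma caccioppoli_pointwise {χ χ' b p q l C δ σ : ℝ} (hδ : 0 < δ) (hb : |b| ≤ δ) (hχ : χ ^ 2 ≤ 1)
    (hχ' : χ' ^ 2 ≤ 1) (hC : 1 + l ^ 2 ≤ C) (hσ : σ ^ 2 = 1) :
    σ * χ ^ 2 * (p - l * q)
      - δ⁻¹ * (χ ^ 2 * (p ^ 2 + q ^ 2) + 2 * χ * χ' * b * (p - l * q)) ≤ 5 / 2 * C * δ := by
  set A := p - l * q with hA
  set g := p ^ 2 + q ^ 2 with hg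
  have hC0 : 0 < C := by nlinarith [sq_nonneg l]
  have hg0 : 0 ≤ g := by positivity
  have hAg : A ^ 2 ≤ C * g := by
    have h1 : A ^ 2 ≤ (1 + l ^ 2) * g := by
      rw [hA, hg]; nlinarith [sq_nonneg (l * p + q)]
    exact h1.trans (by gcongr)
  have hb2 : b ^ 2 ≤ δ ^ 2 := by rw [← sq_abs]; gcongr
  -- Two applications of Young's inequality, here and in `h3`, each absorb half of the gradient term
  -- `χ² g`. The remainders `Cδ²/2` and `2Cδ²` add up to the constant `5/2`.
  have h2 : σ * δ * A ≤ δ ^ 2 * C / 2 + g / 2 := by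
    have : 0 ≤ (δ * C - σ * A) ^ 2 := sq_nonneg _
    have h3 : C * (2 * (σ * δ * A)) ≤ C * (δ ^ 2 * C + g) := by nlinarith
    have := le_of_mul_le_mul_left h3 hC0
    linarith
  have h3 : -(2 * χ * χ' * b * A) ≤ χ ^ 2 * g / 2 + 2 * C * χ' ^ 2 * b ^ 2 := by
    have : 0 ≤ (χ * A + 2 * C * χ' * b) ^ 2 := sq_nonneg _
    have h4 : χ ^ 2 * A ^ 2 ≤ χ ^ 2 * (C * g) := by gcongr
    have h5 : C * (2 * -(2 * χ * χ' * b * A)) ≤ C * (χ ^ 2 * g + 4 * C * χ' ^ 2 * b ^ 2) := by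
      nlinarith
    have := le_of_mul_le_mul_left h5 hC0
    linarith
  have h4 : χ' ^ 2 * b ^ 2 ≤ 1 * δ ^ 2 := by gcongr
  have h5 : χ ^ 2 * (σ * δ * A) ≤ χ ^ 2 * (δ ^ 2 * C / 2 + g / 2) := by gcongr
  have h6 : χ ^ 2 * (δ ^ 2 * C / 2) ≤ 1 * (δ ^ 2 * C / 2) := by gcongr
  have h7 : 2 * C * (χ' ^ 2 * b ^ 2) ≤ 2 * C * (1 * δ ^ 2) := by gcongr
  have h8 : δ * (σ * χ ^ 2 * A - δ⁻¹ * (χ ^ 2 * g + 2 * χ * χ' * b * A))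
      ≤ δ * (5 / 2 * C * δ) := by
    have : δ * (σ * χ ^ 2 * A - δ⁻¹ * (χ ^ 2 * g + 2 * χ * χ' * b * A))
        = σ * χ ^ 2 * A * δ - (χ ^ 2 * g + 2 * χ * χ' * b * A) := by
      field_simp
    rw [this]
    linarith
  exact le_of_mul_le_mul_left h8 hδ

/-- The flux of a harmonic function that is small in a perforated sheared cell is small. -/
lemma IsCellHarmonic.abs_flux_le {H : Set (ℝ × ℝ)} {ell : ℝ → ℝ} {a : ℝ} {B : ℝ × ℝ → ℝ}
    (hB : IsCellHarmonic H ell a B) (hell : ContDiff ℝ 2 ell) (hell1 : ell 1 = ell 0)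
    {C δ : ℝ} (hC : ∀ t ∈ Icc (0 : ℝ) 1, 1 + deriv ell t ^ 2 ≤ C) (hδ : 0 < δ)
    (hBδ : ∀ x ∈ openShearedCell ell a, x ∉ closure H → |B x| ≤ δ) :
    |flux ell (d1 B) (d2 B) a| ≤ 75 * C * δ := by
  have hC0 : 0 < C := by nlinarith [hC 0 (by simp), sq_nonneg (deriv ell 0)]
  -- `X` is the primitive of `χ²` with `X 0 = 0` and `X 1 = 1/30`.
  set X : ℝ → ℝ := fun τ => τ ^ 3 / 3 - τ ^ 4 / 2 + τ ^ 5 / 5 with hX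
  set χ : ℝ → ℝ := fun τ => τ * (1 - τ) with hχ
  have hXd : ∀ τ, HasDerivAt X (χ τ ^ 2) τ := by
    intro τ
    refine ((((hasDerivAt_pow 3 τ).div_const 3).sub ((hasDerivAt_pow 4 τ).div_const 2)).add
      ((hasDerivAt_pow 5 τ).div_const 5)).congr_deriv ?_
    simp only [hχ]; push_cast; ring
  have hχd : ∀ τ, HasDerivAt χ (1 - 2 * τ) τ := by
    intro τ
    refine ((hasDerivAt_id τ).mul ((hasDerivAt_id τ).const_sub 1)).congr_deriv ?_
    simp only [id]; ring
  set T : ℝ × ℝ → ℝ := fun x => x.1 - ell x.2 - a with hT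
  have hTd : ∀ x, HasFDerivAt T (ContinuousLinearMap.fst ℝ ℝ ℝ
      - deriv ell x.2 • ContinuousLinearMap.snd ℝ ℝ ℝ) x := by
    intro x
    have h1 : HasFDerivAt (fun p : ℝ × ℝ => ell p.2)
        (deriv ell x.2 • ContinuousLinearMap.snd ℝ ℝ ℝ) x :=
      (hell.differentiable (by simp) x.2).hasDerivAt.comp_hasFDerivAt x hasFDerivAt_snd
    exact (hasFDerivAt_fst.sub h1).sub_const a
  have hTs : ContDiff ℝ 1 T :=
    (contDiff_fst.sub ((hell.of_le (by decide)).comp contDiff_snd)).sub contDiff_const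
  have key : ∀ σ : ℝ, σ ^ 2 = 1 → σ * flux ell (d1 B) (d2 B) a ≤ 75 * C * δ := by
    intro σ hσ
    -- The term in `X` produces the flux, weighted by `σ/30` on the right edge and by zero on the
    -- left one. The term in `χ² B` vanishes on both edges and supplies a negative `χ² |∇B|²` that
    -- absorbs the gradient. The bound `5/2 C δ` times `30` gives `75 C δ`; the signs `σ = ±1` give
    -- the absolute value.
    set w : ℝ × ℝ → ℝ := fun x => σ * X (T x) - δ⁻¹ * (χ (T x) ^ 2 * B x) with hw
    have hws : ∀ x ∈ shearedCell ell a, x ∉ H → ContDiffAt ℝ 1 w x := by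
      intro x hx hxH
      have hBx : ContDiffAt ℝ 1 B x := (hB.smooth x hx hxH).of_le (by decide)
      have hTx : ContDiffAt ℝ 1 T x := hTs.contDiffAt
      simp only [hw, hX, hχ]
      fun_prop
    have hgreen := hB.setIntegral_grad hell hell1 hws (fun s => by
      have h1 := hB.periodic (s + ell 0, 0)
      simp only [zero_add] at h1
      simp only [hw, hT, hell1, h1])
    have hflux1 : flux ell (fun y => w y * d1 B y) (fun y => w y * d2 B y) (a + 1)
        = σ / 30 * flux ell (d1 B) (d2 B) a := by
      rw [← hB.flux_succ hell hell1]
      unfold flux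
      rw [← intervalIntegral.integral_const_mul]
      congr 1
      ext t
      have hTt : T (a + 1 + ell t, t) = 1 := by simp only [hT]; ring
      have hwt : w (a + 1 + ell t, t) = σ / 30 := by
        simp only [hw, hTt, hX, hχ]; norm_num; ring
      beta_reduce
      rw [hwt]; ring
    have hflux0 : flux ell (fun y => w y * d1 B y) (fun y => w y * d2 B y) a = 0 := by
      unfold flux
      have : ∀ t, w (a + ell t, t) = 0 := by
        intro t
        have hTt : T (a + ell t, t) = 0 := by simp only [hT]; ring
        simp only [hw, hTt, hX, hχ]; norm_num
      simp only [this, zero_mul, mul_zero, sub_zero, intervalIntegral.integral_zero]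
    rw [hflux1, hflux0, sub_zero] at hgreen
    have hle : ∫ x in openShearedCell ell a \ closure H, (d1 w x * d1 B x + d2 w x * d2 B x)
        ≤ 5 / 2 * C * δ := by
      apply setIntegral_le_of_forall_le ((isOpen_openShearedCell
        hell.continuous a).measurableSet.diff isClosed_closure.measurableSet)
      · rw [← volume_shearedCell hell.continuous a]
        exact measure_mono fun x hx => openShearedCell_subset ell a hx.1
      · positivity
      · rintro x ⟨hx, hxH⟩
        have hBx := ((hB.smooth x (openShearedCell_subset ell a hx)
          fun h => hxH (subset_closure h)).differentiableAt (by simp)).hasFDerivAt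
        have e1 : HasFDerivAt (fun x => X (T x)) _ x := (hXd _).comp_hasFDerivAt x (hTd x)
        have e2 : HasFDerivAt (fun x => χ (T x)) _ x := (hχd _).comp_hasFDerivAt x (hTd x)
        have e3 : HasFDerivAt w _ x :=
          (e1.const_mul σ).sub (((e2.pow 2).mul hBx).const_mul δ⁻¹)
        obtain ⟨t1, t2, t3, t4⟩ := hx
        have hτ0 : 0 < T x := by simp only [hT]; linarith
        have hτ1 : T x < 1 := by simp only [hT]; linarith
        refine le_of_eq_of_le ?_ (caccioppoli_pointwise (χ := χ (T x)) (χ' := 1 - 2 * T x)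
          (b := B x) (p := d1 B x) (q := d2 B x) (l := deriv ell x.2) (σ := σ) hδ
          (hBδ x ⟨t1, t2, t3, t4⟩ hxH) ?_ ?_ (hC x.2 ⟨t3.le, t4.le⟩) hσ)
        · simp only [d1, d2, e3.fderiv]
          simp only [sub_apply, add_apply, smul_apply, ContinuousLinearMap.coe_fst',
            ContinuousLinearMap.coe_snd', smul_eq_mul, nsmul_eq_mul]
          push_cast
          ring
        · simp only [hχ]
          have h1 : 0 ≤ T x * (1 - T x) := mul_nonneg hτ0.le (by linarith)
          have h2 : T x * (1 - T x) ≤ 1 := by nlinarith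
          exact pow_le_one₀ h1 h2
        · nlinarith
    rw [hgreen] at hle
    linarith
  rw [abs_le]
  have h1 := key 1 (by norm_num)
  have h2 := key (-1) (by norm_num)
  constructor <;> linarith

lemma eq_zero_of_abs_le {c K : ℝ} (h : ∀ δ > 0, |c| ≤ K * δ) : c = 0 := by
  have ht : Tendsto (fun δ : ℝ => K * δ) (𝓝[>] 0) (𝓝 0) := by
    have : Continuous fun δ : ℝ => K * δ := by fun_prop
    simpa using (this.tendsto 0).mono_left (nhdsWithin_le_nhds (s := Ioi 0))
  have := ge_of_tendsto ht (by
    filter_upwards [self_mem_nhdsWithin] with δ hδ using h δ hδ)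
  exact abs_eq_zero.1 (le_antisymm this (abs_nonneg c))

/-! ### The cell problem: flux of `∇N` and the homogenized coefficient -/

/-- The integral over a sheared cell of a function periodic in the first variable does not depend
on the interface. -/
lemma setIntegral_shearedCell_of_periodic {ell : ℝ → ℝ} (hell : Continuous ell)
    {g : ℝ × ℝ → ℝ} (hg : IntegrableOn g (shearedCell ell 0))
    (hper : ∀ x : ℝ × ℝ, g (x.1 + 1, x.2) = g x) :
    ∫ x in shearedCell ell 0, g x = ∫ t in Icc (0 : ℝ) 1, ∫ s in (0 : ℝ)..1, g (s, t) := by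
  have hI : IntegrableOn (fun p => g (shear ell p)) (Icc (0 : ℝ) 1 ×ˢ Icc (0 : ℝ) 1) := by
    have := ((measurePreserving_shear hell).integrableOn_comp_preimage
      (measurableEmbedding_shear hell)).2 hg
    rw [shear_preimage_shearedCell, Icc_prod_eq, zero_add] at this
    exact this
  rw [setIntegral_shearedCell hell, Icc_prod_eq]
  simp only [zero_add]
  rw [IntegrableOn, Measure.volume_eq_prod, ← Measure.prod_restrict] at hI
  rw [Measure.volume_eq_prod, ← Measure.prod_restrict, integral_prod_symm _ hI]
  congr 1
  ext t
  have hp : Function.Periodic (fun s => g (s, t)) 1 := fun s => hper (s, t)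
  rw [integral_Icc_eq_integral_Ioc, ← intervalIntegral.integral_of_le zero_le_one]
  simp only [shear]
  rw [intervalIntegral.integral_comp_add_right (fun s => g (s, t)) (ell t)]
  -- On each horizontal line the shear only moves the starting point of a full period.
  have := hp.intervalIntegral_add_eq (ell t) 0
  simpa [add_comm] using this

section Cell

variable {G : Set (ℝ × ℝ)} {N : ℝ × ℝ → ℝ} {ell : ℝ → ℝ}

lemma IsCellSolution.shift (hN : IsCellSolution G N) (k n : ℤ) (x : ℝ × ℝ) :
    N (x + ((k : ℝ), (n : ℝ))) = N x :=
  apply_add_intCast hN.periodic_fst hN.periodic_snd x k n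

lemma IsCellSolution.lap_eq_zero (hN : IsCellSolution G N) (hG : IsHoleSystem G) {x : ℝ × ℝ}
    (hx : x ∉ closure (periodicHoles G)) : lap N x = 0 := by
  set y : ℝ × ℝ := (Int.fract x.1, Int.fract x.2) with hy
  have hxy : y + ((⌊x.1⌋ : ℝ), (⌊x.2⌋ : ℝ)) = x := by
    ext <;> simp [hy]
  rw [← hxy, lap_eq_of_shift (hN.shift _ _)]
  apply hN.harmonic
  rw [hG.cell_eq]
  refine ⟨⟨⟨Int.fract_nonneg _, (Int.fract_lt_one _).le⟩,
    ⟨Int.fract_nonneg _, (Int.fract_lt_one _).le⟩⟩, fun h => hx ?_⟩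
  rw [← hxy]
  exact (mem_closure_periodicHoles_add y _ _).2 h

lemma IsCellSolution.tangential (hN : IsCellSolution G N) (hG : IsHoleSystem G) {x : ℝ × ℝ}
    (hx : x ∈ frontier (periodicHoles G)) {ψ : ℝ × ℝ → ℝ}
    (hψ : IsDefiningFunction (periodicHoles G) x ψ) :
    (1 + d1 N x) * d1 ψ x + d2 N x * d2 ψ x = 0 := by
  obtain ⟨k, n, h1, h2⟩ := hG.isUnitNormalInto_shift hx
  obtain ⟨ν, t, hν, e1, e2⟩ := hψ.exists_isUnitNormalInto
  have h3 := hN.neumann _ h1 ν (h2 ν hν)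
  have hxv : (x.1 - (k : ℝ), x.2 - (n : ℝ)) + ((k : ℝ), (n : ℝ)) = x := by simp
  rw [normalDeriv, ← d1_eq_of_shift (hN.shift k n), ← d2_eq_of_shift (hN.shift k n), hxv] at h3
  rw [e1, e2]
  linear_combination (-t) * h3

lemma IsCellSolution.smooth_grad (hN : IsCellSolution G N) {x : ℝ × ℝ}
    (hx : x ∉ periodicHoles G) : ContDiffAt ℝ 1 (fun y => 1 + d1 N y) x ∧
      ContDiffAt ℝ 1 (d2 N) x :=
  ⟨contDiffAt_const.add (contDiffAt_d1 (hN.smooth x hx) (by decide)),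
    contDiffAt_d2 (hN.smooth x hx) (by decide)⟩

lemma IsInterfaceProfile.contDiff_two (hell : IsInterfaceProfile G ell) : ContDiff ℝ 2 ell :=
  hell.smooth.of_le (by decide)

lemma IsInterfaceProfile.continuous_deriv (hell : IsInterfaceProfile G ell) :
    Continuous (deriv ell) :=
  hell.smooth.continuous_deriv (by decide)

lemma IsInterfaceProfile.apply_one (hell : IsInterfaceProfile G ell) : ell 1 = ell 0 := by
  simpa using hell.periodic 0

lemma IsInterfaceProfile.notMem_periodicHoles (hell : IsInterfaceProfile G ell)
    (hG : IsHoleSystem G) (t : ℝ) : (ell t, t) ∉ periodicHoles G := fun h =>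
  hell.notMem_closure hG 0 t (by simpa using subset_closure h)

lemma normalDeriv_mul_sqrt (u : ℝ × ℝ → ℝ) (x : ℝ × ℝ) (t : ℝ) :
    normalDeriv u x (interfaceNormal ell t) * √(1 + deriv ell t ^ 2)
      = d1 u x - deriv ell t * d2 u x := by
  have : √(1 + deriv ell t ^ 2) ≠ 0 := (Real.sqrt_pos.2 (by positivity)).ne'
  simp only [normalDeriv, interfaceNormal]
  field_simp
  ring

lemma lineIntegral_normalDeriv (u : ℝ × ℝ → ℝ) :
    lineIntegral ell (fun t => normalDeriv u (ell t, t) (interfaceNormal ell t))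
      = flux ell (d1 u) (d2 u) 0 := by
  simp only [lineIntegral, flux, normalDeriv_mul_sqrt, zero_add]

lemma continuous_flux_integrand (hell : Continuous ell) (hell' : Continuous (deriv ell))
    {F₁ F₂ : ℝ × ℝ → ℝ} (h₁ : ∀ t, ContinuousAt F₁ (ell t, t))
    (h₂ : ∀ t, ContinuousAt F₂ (ell t, t)) :
    Continuous fun t => F₁ (ell t, t) - deriv ell t * F₂ (ell t, t) := by
  have hc : Continuous fun t => (ell t, t) := hell.prodMk continuous_id
  have k1 : Continuous fun t => F₁ (ell t, t) := continuous_iff_continuousAt.2 fun t =>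
    ContinuousAt.comp (f := fun t => (ell t, t)) (h₁ t) hc.continuousAt
  have k2 : Continuous fun t => F₂ (ell t, t) := continuous_iff_continuousAt.2 fun t =>
    ContinuousAt.comp (f := fun t => (ell t, t)) (h₂ t) hc.continuousAt
  exact k1.sub (hell'.mul k2)

/-- The integral of `1 + ∂N/∂ξ₁` over a perforated sheared cell is its flux through the
interface. -/
lemma IsCellSolution.setIntegral_shearedCell (hN : IsCellSolution G N) (hG : IsHoleSystem G)
    (hell : IsInterfaceProfile G ell) :
    ∫ x in shearedCell ell 0 \ closure (periodicHoles G), (1 + d1 N x)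
      = flux ell (fun x => 1 + d1 N x) (d2 N) 0 := by
  -- The weight `ξ₁` has gradient `e₁`, so `ξ₁ (e₁ + ∇N)` has divergence `1 + ∂₁N`.
  have hsm : ∀ x ∉ periodicHoles G, ContDiffAt ℝ 1 (fun y : ℝ × ℝ => y.1 * (1 + d1 N y)) x ∧
      ContDiffAt ℝ 1 (fun y : ℝ × ℝ => y.1 * d2 N y) x := fun x hx =>
    ⟨contDiffAt_fst.mul (hN.smooth_grad hx).1, contDiffAt_fst.mul (hN.smooth_grad hx).2⟩
  have ht : IsTangential (periodicHoles G) (openShearedCell ell 0)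
      (fun y => y.1 * (1 + d1 N y)) (fun y => y.1 * d2 N y) :=
    { smooth := fun x _ hx => hsm x hx
      smooth_boundary := fun x hx _ => hG.smooth_boundary_periodicHoles hx
      tangential := fun x hx _ ψ hψ => by
        have := hN.tangential hG hx hψ
        linear_combination x.1 * this }
  have hinter := hell.closure_inter_shearedCell hG 0
  rw [Int.cast_zero] at hinter
  have h01 : ∀ s, d2 N (s, 1) = d2 N (s, 0) := fun s => by
    simpa using d2_eq_of_shift (hN.shift 0 1) (s, 0)
  have hdiv := ht.setIntegral_dvg hell.contDiff_two hinter (fun x _ hx => hsm x hx)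
    (fun s _ => by simp only [hell.apply_one, h01])
  have hcongr : ∫ x in shearedCell ell 0 \ closure (periodicHoles G), (1 + d1 N x)
      = ∫ x in shearedCell ell 0 \ closure (periodicHoles G),
        dvg (fun y => y.1 * (1 + d1 N y)) (fun y => y.1 * d2 N y) x := by
    refine setIntegral_congr_fun ((isCompact_shearedCell
      hell.smooth.continuous 0).isClosed.measurableSet.diff isClosed_closure.measurableSet)
      fun x hx => ?_
    have hxP : x ∉ periodicHoles G := fun h => hx.2 (subset_closure h)
    have hlap : dvg (fun y => 1 + d1 N y) (d2 N) x = 0 := by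
      have := hN.lap_eq_zero hG hx.2
      simp only [dvg, lap, d1, d2, fderiv_const_add] at this ⊢
      exact this
    rw [dvg_smul differentiableAt_fst ((hN.smooth_grad hxP).1.differentiableAt (by simp))
      ((hN.smooth_grad hxP).2.differentiableAt (by simp)), hlap]
    simp [d1, d2, fderiv_fst]
  rw [hcongr, hdiv]
  have s1 : ∀ t, d1 N (0 + 1 + ell t, t) = d1 N (ell t, t) := fun t => by
    have := d1_eq_of_shift (hN.shift 1 0) (ell t, t)
    simpa [add_comm] using this
  have s2 : ∀ t, d2 N (0 + 1 + ell t, t) = d2 N (ell t, t) := fun t => by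
    have := d2_eq_of_shift (hN.shift 1 0) (ell t, t)
    simpa [add_comm] using this
  have hcurve := fun t => hN.smooth_grad (hell.notMem_periodicHoles hG t)
  have hc := continuous_flux_integrand hell.smooth.continuous hell.continuous_deriv
    (fun t => (hcurve t).1.continuousAt) (fun t => (hcurve t).2.continuousAt)
  have hc2 : Continuous fun t => ell t * (1 + d1 N (ell t, t) - deriv ell t * d2 N (ell t, t)) :=
    hell.smooth.continuous.mul hc
  simp only [flux, s1, s2]
  -- The weights on the two edges are `1 + ell t` and `ell t`; only their difference survives.
  rw [← intervalIntegral.integral_sub]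
  · congr 1
    ext t
    simp only [zero_add]
    ring
  · refine Continuous.intervalIntegrable ?_ 0 1
    convert hc.add hc2 using 1
    ext t
    simp only [Pi.add_apply]
    ring
  · refine Continuous.intervalIntegrable ?_ 0 1
    convert hc2 using 1
    ext t
    simp only [zero_add]
    ring

lemma IsCellSolution.setIntegral_cell (hN : IsCellSolution G N) (hG : IsHoleSystem G)
    (hell : IsInterfaceProfile G ell) :
    ∫ x in cell G, (1 + d1 N x)
      = ∫ x in shearedCell ell 0 \ closure (periodicHoles G), (1 + d1 N x) := by
  -- Extension by zero into the holes gives a function periodic in the plane. The square is the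
  -- sheared cell of the zero profile, so both integrals reduce to the same iterated one.
  set g : ℝ × ℝ → ℝ := indicator (closure (periodicHoles G))ᶜ fun x => 1 + d1 N x with hg
  have hmc : MeasurableSet (closure (periodicHoles G))ᶜ := isClosed_closure.measurableSet.compl
  have hper : ∀ x : ℝ × ℝ, g (x.1 + 1, x.2) = g x := by
    intro x
    have h1 : (x.1 + 1, x.2) ∈ closure (periodicHoles G) ↔ x ∈ closure (periodicHoles G) := by
      simpa using mem_closure_periodicHoles_add (G := G) x 1 0
    have h2 : d1 N (x.1 + 1, x.2) = d1 N x := by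
      rw [← d1_eq_of_shift (hN.shift 1 0) x]
      congr 1; ext <;> simp
    by_cases hx : x ∈ closure (periodicHoles G)
    · rw [hg, indicator_of_notMem (by exact fun h => h (h1.2 hx)),
        indicator_of_notMem (by exact fun h => h hx)]
    · rw [hg, indicator_of_mem (by exact fun h => hx (h1.1 h)), indicator_of_mem (by exact hx), h2]
  have hint : ∀ f : ℝ → ℝ, Continuous f → IntegrableOn g (shearedCell f 0) := by
    intro f hf
    have hk : IsCompact (shearedCell f 0 \ periodicHoles G) :=
      (isCompact_shearedCell hf 0).diff hG.isOpen_periodicHoles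
    have hi : IntegrableOn (fun x => 1 + d1 N x) (shearedCell f 0 \ periodicHoles G) :=
      ContinuousOn.integrableOn_compact hk fun x hx =>
        (hN.smooth_grad hx.2).1.continuousAt.continuousWithinAt
    rw [hg, IntegrableOn, integrable_indicator_iff hmc, IntegrableOn,
      Measure.restrict_restrict hmc]
    exact hi.mono_set fun x hx => ⟨hx.2, fun h => hx.1 (subset_closure h)⟩
  have hset : ∀ f : ℝ → ℝ, ∫ x in shearedCell f 0, g x
      = ∫ x in shearedCell f 0 \ closure (periodicHoles G), (1 + d1 N x) := by
    intro f
    rw [hg, setIntegral_indicator hmc, Set.sdiff_eq]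
  have hc : Icc (0 : ℝ) 1 ×ˢ Icc (0 : ℝ) 1 = shearedCell (fun _ => 0) 0 := by
    ext x
    simp only [shearedCell, mem_prod, mem_Icc, mem_ofPred_eq, sub_zero, zero_add]
    tauto
  rw [hG.cell_eq, hc, ← hset, ← hset,
    setIntegral_shearedCell_of_periodic continuous_const (hint _ continuous_const) hper,
    setIntegral_shearedCell_of_periodic hell.smooth.continuous
      (hint _ hell.smooth.continuous) hper]

/-- If the area is zero, both sides vanish, so its positivity is not needed. -/
lemma volume_cell_mul_h11 (G : Set (ℝ × ℝ)) (N : ℝ × ℝ → ℝ) :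
    volume.real (cell G) * h11 G N = ∫ x in cell G, (1 + d1 N x) := by
  simp only [h11, cellAverage]
  by_cases h : volume.real (cell G) = 0
  · have hfin : volume (cell G) ≠ ⊤ :=
      (measure_mono_top sdiff_subset).mt (isCompact_Icc.prod isCompact_Icc).measure_lt_top.ne
    have h0 : volume (cell G) = 0 := by
      rwa [measureReal_eq_zero_iff hfin] at h
    rw [h, zero_mul, setIntegral_measure_zero _ h0]
  · field_simp

/-- The flux of `∇N` through the interface. -/
lemma IsCellSolution.flux_eq (hN : IsCellSolution G N) (hG : IsHoleSystem G)
    (hell : IsInterfaceProfile G ell) :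
    flux ell (d1 N) (d2 N) 0 = -1 + volume.real (cell G) * h11 G N := by
  rw [volume_cell_mul_h11, hN.setIntegral_cell hG hell, hN.setIntegral_shearedCell hG hell]
  have hcurve := fun t => hN.smooth_grad (hell.notMem_periodicHoles hG t)
  have hd1 : ∀ t, ContinuousAt (d1 N) (ell t, t) := fun t =>
    (contDiffAt_d1 (m := 0) (hN.smooth _ (hell.notMem_periodicHoles hG t))
      (by decide)).continuousAt
  have hc := continuous_flux_integrand hell.smooth.continuous hell.continuous_deriv
    hd1 (fun t => (hcurve t).2.continuousAt)
  have : ∀ t, 1 + d1 N (ell t, t) - deriv ell t * d2 N (ell t, t)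
      = 1 + (d1 N (ell t, t) - deriv ell t * d2 N (ell t, t)) := fun t => by ring
  simp only [flux, zero_add, this]
  rw [intervalIntegral.integral_add (by simp) (hc.intervalIntegrable 0 1)]
  simp

/-! ### The inner-layer problem -/

lemma IsInterfaceProfile.exists_bounds (hell : IsInterfaceProfile G ell) :
    ∃ C E, (∀ t ∈ Icc (0 : ℝ) 1, 1 + deriv ell t ^ 2 ≤ C) ∧ ∀ t ∈ Icc (0 : ℝ) 1, |ell t| ≤ E := by
  have h1 : Continuous fun t => 1 + deriv ell t ^ 2 := by
    have := hell.continuous_deriv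
    fun_prop
  obtain ⟨C, hC⟩ := isCompact_Icc.exists_bound_of_continuousOn (s := Icc (0 : ℝ) 1)
    h1.continuousOn
  obtain ⟨E, hE⟩ := isCompact_Icc.exists_bound_of_continuousOn (s := Icc (0 : ℝ) 1)
    hell.smooth.continuous.continuousOn
  exact ⟨C, E, fun t ht => (le_abs_self _).trans (hC t ht), hE⟩

variable {Dm q J : ℝ} {Bp Bm : ℝ × ℝ → ℝ}

lemma IsInnerLayerSolution.isCellHarmonic_plus (hB : IsInnerLayerSolution G ell N Dm q J Bp Bm)
    (hG : IsHoleSystem G) (hell : IsInterfaceProfile G ell) (m : ℕ) :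
    IsCellHarmonic (periodicHoles G) ell m Bp :=
  { inter_subset := by simpa using hell.closure_inter_shearedCell hG m
    smooth := fun x hx hxP => hB.smooth_plus x (by
      have := hx.1
      have : (0 : ℝ) ≤ m := by positivity
      linarith) hxP
    periodic := hB.periodic_plus
    harmonic := fun x hx hxP => by
      refine hB.harmonic_plus x ⟨?_, hx.2.2.1, hx.2.2.2, hxP⟩
      have := hx.1
      have : (0 : ℝ) ≤ m := by positivity
      linarith
    smooth_boundary := fun x hx _ => hG.smooth_boundary_periodicHoles hx
    neumann := fun x hx hxO ψ hψ => by
      obtain ⟨ν, t, hν, e1, e2⟩ := hψ.exists_isUnitNormalInto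
      have h := hB.neumann x hx (by
        have := hxO.1
        have : (0 : ℝ) ≤ m := by positivity
        linarith) hxO.2.2.1 hxO.2.2.2 ν hν
      rw [normalDeriv] at h
      rw [e1, e2]
      linear_combination (-t) * h }

/-- There are no holes on the left. With the offset `-m - 1` the right edge is the interface shifted
by `-m`; for `m = 0` it is the interface itself. -/
lemma IsInnerLayerSolution.isCellHarmonic_minus (hB : IsInnerLayerSolution G ell N Dm q J Bp Bm)
    (m : ℕ) : IsCellHarmonic ∅ ell (-(m : ℝ) - 1) Bm :=
  { inter_subset := by simp
    smooth := fun x hx _ => hB.smooth_minus x (by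
      have := hx.2.1
      have : (0 : ℝ) ≤ m := by positivity
      linarith)
    periodic := hB.periodic_minus
    harmonic := fun x hx _ => by
      refine hB.harmonic_minus x ⟨?_, hx.2.2.1, hx.2.2.2⟩
      have := hx.2.1
      have : (0 : ℝ) ≤ m := by positivity
      linarith
    smooth_boundary := fun x hx => by simp at hx
    neumann := fun x hx => by simp at hx }

lemma IsInnerLayerSolution.flux_plus (hB : IsInnerLayerSolution G ell N Dm q J Bp Bm)
    (hG : IsHoleSystem G) (hell : IsInterfaceProfile G ell) :
    flux ell (d1 Bp) (d2 Bp) 0 = 0 := by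
  obtain ⟨C, E, hC, hE⟩ := hell.exists_bounds
  have hconst : ∀ m : ℕ, flux ell (d1 Bp) (d2 Bp) m = flux ell (d1 Bp) (d2 Bp) 0 := by
    intro m
    induction m with
    | zero => simp
    | succ m ih =>
      rw [← ih, Nat.cast_succ]
      exact (hB.isCellHarmonic_plus hG hell m).flux_succ hell.contDiff_two hell.apply_one
  refine eq_zero_of_abs_le (K := 75 * C) fun δ hδ => ?_
  have hev := hB.decay_plus.eventually (Metric.ball_mem_nhds 0 hδ)
  rw [eventually_inf_principal, eventually_comap] at hev
  obtain ⟨R, hR⟩ := eventually_atTop.1 hev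
  -- As `ell ≥ -E` on the period, the `m`-th cell lies beyond abscissa `R`, where `|Bp| < δ`.
  obtain ⟨m, hm⟩ := exists_nat_ge (R + E)
  rw [← hconst m]
  refine (hB.isCellHarmonic_plus hG hell m).abs_flux_le hell.contDiff_two hell.apply_one hC hδ
    fun x hx hxP => ?_
  obtain ⟨h1, h2, h3, h4⟩ := hx
  have hb := neg_le_of_abs_le (hE x.2 ⟨h3.le, h4.le⟩)
  have hm0 : (0 : ℝ) ≤ m := by positivity
  have := hR x.1 (by linarith) x rfl ⟨by linarith, h3, h4, hxP⟩
  exact (mem_ball_zero_iff.1 this).le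

lemma IsInnerLayerSolution.flux_minus (hB : IsInnerLayerSolution G ell N Dm q J Bp Bm)
    (hell : IsInterfaceProfile G ell) : flux ell (d1 Bm) (d2 Bm) 0 = 0 := by
  obtain ⟨C, E, hC, hE⟩ := hell.exists_bounds
  have hconst : ∀ m : ℕ, flux ell (d1 Bm) (d2 Bm) (-(m : ℝ)) = flux ell (d1 Bm) (d2 Bm) 0 := by
    intro m
    induction m with
    | zero => simp
    | succ m ih =>
      have := (hB.isCellHarmonic_minus m).flux_succ hell.contDiff_two hell.apply_one
      rw [sub_add_cancel] at this
      rw [← ih, this, Nat.cast_succ, neg_add, sub_eq_add_neg]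
  refine eq_zero_of_abs_le (K := 75 * C) fun δ hδ => ?_
  have hev := hB.decay_minus.eventually (Metric.ball_mem_nhds 0 hδ)
  rw [eventually_inf_principal, eventually_comap] at hev
  obtain ⟨R, hR⟩ := eventually_atBot.1 hev
  obtain ⟨m, hm⟩ := exists_nat_ge (E - R)
  have h0 := hconst (m + 1)
  rw [Nat.cast_succ, neg_add, ← sub_eq_add_neg] at h0
  rw [← h0]
  refine (hB.isCellHarmonic_minus m).abs_flux_le hell.contDiff_two hell.apply_one hC hδ
    fun x hx _ => ?_
  obtain ⟨h1, h2, h3, h4⟩ := hx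
  have hb := le_of_abs_le (hE x.2 ⟨h3.le, h4.le⟩)
  have hm0 : (0 : ℝ) ≤ m := by positivity
  have := hR x.1 (by linarith) x rfl ⟨by linarith, h3, h4⟩
  exact (mem_ball_zero_iff.1 this).le

/-- The constant in the flux condition of the inner-layer problem is the flux of `∇N`. -/
lemma IsInnerLayerSolution.const_eq_flux (hB : IsInnerLayerSolution G ell N Dm q J Bp Bm)
    (hG : IsHoleSystem G) (hN : IsCellSolution G N) (hell : IsInterfaceProfile G ell) :
    J = flux ell (d1 N) (d2 N) 0 := by
  have hgrad : ∀ (u : ℝ × ℝ → ℝ), (∀ t, ContDiffAt ℝ 2 u (ell t, t)) →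
      Continuous fun t => d1 u (ell t, t) - deriv ell t * d2 u (ell t, t) := fun u hu =>
    continuous_flux_integrand hell.smooth.continuous hell.continuous_deriv
      (fun t => (contDiffAt_d1 (m := 0) (hu t) (by decide)).continuousAt)
      (fun t => (contDiffAt_d2 (m := 0) (hu t) (by decide)).continuousAt)
  have cp := hgrad Bp fun t => hB.smooth_plus _ le_rfl (hell.notMem_periodicHoles hG t)
  have cm := hgrad Bm fun t => hB.smooth_minus _ le_rfl
  have cN := hgrad N fun t => (hN.smooth _ (hell.notMem_periodicHoles hG t)).of_le (by decide)
  have hjump : ∀ t ∈ Ioo (0 : ℝ) 1,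
      d1 Bp (ell t, t) - deriv ell t * d2 Bp (ell t, t)
        - Dm * (d1 Bm (ell t, t) - deriv ell t * d2 Bm (ell t, t))
        + (d1 N (ell t, t) - deriv ell t * d2 N (ell t, t)) = J := by
    intro t ht
    have h := hB.flux_jump t ht
    have hs : √(1 + deriv ell t ^ 2) ≠ 0 := (Real.sqrt_pos.2 (by positivity)).ne'
    have hn : (interfaceNormal ell t).1 * √(1 + deriv ell t ^ 2) = 1 := by
      simp only [interfaceNormal]; field_simp
    simp only [← normalDeriv_mul_sqrt]
    linear_combination √(1 + deriv ell t ^ 2) * h + J * hn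
  have hint : ∫ t in (0 : ℝ)..1, (d1 Bp (ell t, t) - deriv ell t * d2 Bp (ell t, t)
        - Dm * (d1 Bm (ell t, t) - deriv ell t * d2 Bm (ell t, t))
        + (d1 N (ell t, t) - deriv ell t * d2 N (ell t, t))) = J := by
    -- The flux condition holds only for `0 < t < 1`; the endpoints are negligible.
    rw [intervalIntegral.integral_of_le zero_le_one, integral_Ioc_eq_integral_Ioo,
      setIntegral_congr_fun measurableSet_Ioo hjump]
    simp
  have cd : Continuous fun t => d1 Bp (ell t, t) - deriv ell t * d2 Bp (ell t, t)
      - Dm * (d1 Bm (ell t, t) - deriv ell t * d2 Bm (ell t, t)) := cp.sub (cm.const_mul Dm)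
  rw [intervalIntegral.integral_add (cd.intervalIntegrable 0 1)
    (cN.intervalIntegrable 0 1), intervalIntegral.integral_sub (cp.intervalIntegrable 0 1)
    ((cm.const_mul Dm).intervalIntegrable 0 1), intervalIntegral.integral_const_mul] at hint
  have fp := hB.flux_plus hG hell
  have fm := hB.flux_minus hell
  simp only [flux, zero_add] at fp fm ⊢
  rw [fp, fm] at hint
  linarith

end Cell

end PerforatedCell

theorem proposition5p1
    (G : Set (ℝ × ℝ)) (hG : PerforatedCell.IsHoleSystem G)
    (hsymm : PerforatedCell.IsSymmetricCell G)
    (N : ℝ × ℝ → ℝ) (hN : PerforatedCell.IsCellSolution G N)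
    (ell : ℝ → ℝ) (hell : PerforatedCell.IsInterfaceProfile G ell) :
    PerforatedCell.lineIntegral ell (fun t =>
        PerforatedCell.normalDeriv N (ell t, t) (PerforatedCell.interfaceNormal ell t))
      = -1 + volume.real (PerforatedCell.cell G) * PerforatedCell.h11 G N ∧
    ∀ (Dm : ℝ), 0 < Dm → ∀ (q J : ℝ) (Bp Bm : ℝ × ℝ → ℝ),
      PerforatedCell.IsInnerLayerSolution G ell N Dm q J Bp Bm →
        J = -1 + volume.real (PerforatedCell.cell G) * PerforatedCell.h11 G N := by
  have hflux := hN.flux_eq hG hell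
  refine ⟨(PerforatedCell.lineIntegral_normalDeriv N).trans hflux, ?_⟩
  intro Dm _ q J Bp Bm hB
  exact (hB.const_eq_flux hG hN hell).trans hflux
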